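/- Let $(R,\mathfrak m)$ be a $d$-dimensional regular local ring with fraction field $K$, and let $V$ be a valuation ring of $K$ that birationally dominates $R$ (that is, $R\subseteq V\subseteq K$ and $\mathfrak m_V\cap R=\mathfrak m$), of rank $1$ (Krull dimension $1$) and of rational rank $d$ (that is, $\dim_{\mathbb Q}(\Gamma\otimes_{\mathbb Z}\mathbb Q)=d$, where $\Gamma$ is the value group of $V$). Let $$R=R_0\subseteq R_1\subseteq\cdots\subseteq R_n\subseteq\cdots\subseteq V$$ be the sequence of local quadratic transforms of $R$ along $V$: with $\mathfrak m_n$ the maximal ideal of $R_n$ and $a\in\mathfrak m_n$ such that $aV=\mathfrak m_nV$, the ring $R_{n+1}$ is the localization of $R_n[\mathfrak m_n/a]\subseteq V$ at the prime ideal $\mathfrak m_V\cap R_n[\mathfrak m_n/a]$. Suppose that $V=\bigcup_{n\ge 0}R_n$. Then there exist an integer $n\ge 0$ and a regular system of parameters $x_1,\dots,x_d$ of $R_n$ such that the sequence $\{R_i\}_{i\ge n}$ is monomial in $x_1,\dots,x_d$. Explicitly: for every $i\ge n$ there is a regular system of parameters $w_{i,1},\dots,w_{i,d}$ of the $d$-dimensional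 regular local ring $R_i$, with $w_{n,k}=x_k$ for all $k$, such that for every $i\ge n$ there is an index $j$ for which $w_{i+1,j}=w_{i,j}$, $w_{i+1,k}=w_{i,k}/w_{i,j}$ for $k\ne j$, and $R_{i+1}$ is the localization of $R_i[\mathfrak m_i/w_{i,j}]$ at the prime ideal generated by $w_{i+1,1},\dots,w_{i+1,d}$. -/

import Mathlib

open IsLocalRing
open scoped TensorProduct

/-- The rational rank `dim_ℚ (ℚ ⊗ Γ)` of the value group `Γ` of a valuation ring `V` of `K`.
The nonzero part of `V.ValueGroup` is `Γ`, written multiplicatively. -/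
noncomputable def ValuationSubring.rationalRank {K : Type*} [Field K]
    (V : ValuationSubring K) : Cardinal :=
  Module.rank ℚ (ℚ ⊗[ℤ] Additive (V.ValueGroup)ˣ)

namespace LocalSubring

variable {K : Type*} [Field K]

/-- For a local subring `A` of `K` with maximal ideal `m` and `a : K`,
the subring `A[m/a]` of `K`. -/
def blowupChart (A : LocalSubring K) (a : K) : Subring K :=
  (Algebra.adjoin A.toSubring
    {z : K | ∃ b : A.toSubring, b ∈ maximalIdeal A.toSubring ∧ z = (b : K) / a}).toSubring

/-- The center on the subring `C` of a local subring `B` containing it: the ideal `m_B ∩ C`. -/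
def centerOn (B : LocalSubring K) {C : Subring K} (h : C ≤ B.toSubring) : Ideal C :=
  (maximalIdeal B.toSubring).comap (Subring.inclusion h)

instance (B : LocalSubring K) {C : Subring K} (h : C ≤ B.toSubring) : (B.centerOn h).IsPrime :=
  Ideal.comap_isPrime (Subring.inclusion h) (maximalIdeal B.toSubring)

/-- `B` is the local quadratic transform of `A` along the valuation ring `V`: for some `a ∈ m`
with `aV = mV` one has `A[m/a] ⊆ V`, and `B` is the localization of `A[m/a]` at the center
of `V` on `A[m/a]`. -/
def IsQuadraticTransformAlong (V : ValuationSubring K) (A B : LocalSubring K) : Prop :=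
  ∃ a : A.toSubring, a ∈ maximalIdeal A.toSubring ∧
    (∀ b ∈ maximalIdeal A.toSubring, V.valuation (b : K) ≤ V.valuation (a : K)) ∧
    ∃ h : A.blowupChart a ≤ V.toLocalSubring.toSubring,
      B = ofPrime (A.blowupChart a) (V.toLocalSubring.centerOn h)

/-- `S 0 ⊆ S 1 ⊆ ⋯` is the sequence of local quadratic transforms of `A` along `V`. -/
def IsQuadraticSequenceAlong (V : ValuationSubring K) (A : LocalSubring K)
    (S : ℕ → LocalSubring K) : Prop :=
  S 0 = A ∧ ∀ n, IsQuadraticTransformAlong V (S n) (S (n + 1))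

/-- `A` is a `d`-dimensional regular local ring and `x 0, …, x (d - 1)` are elements of `A`
generating its maximal ideal. -/
def IsRegularSystemOfParameters {d : ℕ} (A : LocalSubring K) (x : Fin d → K) : Prop :=
  IsRegularLocalRing A.toSubring ∧ ringKrullDim A.toSubring = d ∧
    ∃ y : Fin d → A.toSubring, (∀ k, (y k : K) = x k) ∧
      Ideal.span (Set.range y) = maximalIdeal A.toSubring

/-- The new variables after a monomial transform in the direction of the `j`-th variable:
`x j` is kept, and each other `x k` is replaced by `x k / x j`. -/
def monomialStep {d : ℕ} (j : Fin d) (x : Fin d → K) : Fin d → K :=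
  fun k => if k = j then x j else x k / x j

/-- `B` is the monomial local quadratic transform of `A` in the direction of the `j`-th of the
variables `x`: the localization of `A[m / x j]` at the prime ideal generated by the
new variables. -/
def IsMonomialTransform {d : ℕ} (A : LocalSubring K) (x : Fin d → K) (j : Fin d)
    (B : LocalSubring K) : Prop :=
  ∃ y : Fin d → A.blowupChart (x j), (∀ k, (y k : K) = monomialStep j x k) ∧
    ∃ _ : (Ideal.span (Set.range y)).IsPrime,
      B = ofPrime (A.blowupChart (x j)) (Ideal.span (Set.range y))

/-- The sequence `S` is monomial in the variables `x` of `S 0`: there are variables `w i` of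
every `S i`, with `w 0 = x`, such that every `S (i + 1)` is the monomial local quadratic transform
of `S i` in the direction of one of the variables `w i`, and `w (i + 1)` consists of the
corresponding new variables. -/
def IsMonomialSequence {d : ℕ} (S : ℕ → LocalSubring K) (x : Fin d → K) : Prop :=
  ∃ w : ℕ → Fin d → K, w 0 = x ∧ (∀ i, IsRegularSystemOfParameters (S i) (w i)) ∧
    ∀ i, ∃ j : Fin d, IsMonomialTransform (S i) (w i) j (S (i + 1)) ∧
      w (i + 1) = monomialStep j (w i)

end LocalSubring

/-! Since `K` is the fraction field of `R`, there are nonzero `f i` in `R`, for `i : Fin d`, whose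
values form a basis of `ℚ ⊗ Γ`. Follow one nonzero variable `w₀ j` of `R` along the sequence. A
quadratic transform turns each variable `w k` into `(w k / w j) * w j`, where the quotient is a new
variable or a unit, so `w₀ j` remains a product of variables and units (`exists_mem_closure`). As
`V` has rank 1, some `w₀ j ^ c / ∏ i, f i` lies in `V`, hence in some `R_n` because `V` is the
union. In `R_n` every `f i` thus divides a product of variables and units. The variables are prime
elements, so the value of `f i` is a rational combination of their values (`valueVec_mem_span`).

The values of the `d` variables of `R_n` therefore span a space of dimension `d` and are
independent. In particular they are distinct, one variable has strictly least value, the next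
transform is monomial, and the new values span again (`exists_monomialStep`). Recursion finishes the
proof.

Two facts about the rings `R_n` are needed. Their maximal ideals have `d` generators, because
adjoining one element and localizing costs one generator (`Generates.exists_hull_adjoin`). Their
dimension is at least `d` by an Abhyankar inequality, proved by counting values against lengths
(`Dominates.le_ringKrullDim`). Together these give regularity.

`V.valuation` is multiplicative: the least value in the additive sense is the largest `V.valuation`.
-/

/-! ### Regular local rings are domains and their parameters are prime. -/

theorem exists_isPrime_le_ringKrullDim_quotient {R : Type*} [CommRing R] (n : ℕ) 
    (h : n ≤ ringKrullDim R) :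
    ∃ p : Ideal R, p.IsPrime ∧ n ≤ ringKrullDim (R ⧸ p) := by
  obtain ⟨l, hl⟩ := Order.le_krullDim_iff.mp h
  refine ⟨l.head.asIdeal, l.head.isPrime, ?_⟩
  rw [ringKrullDim_quotient]
  refine Order.le_krullDim_iff.mpr ⟨LTSeries.mk l.length
    (fun i => ⟨l i, ?_⟩) ?_, hl⟩
  · exact (PrimeSpectrum.mem_zeroLocus _ _).mpr (LTSeries.head_le l i)
  · intro i j hij
    exact l.strictMono hij

section RegularDomain

variable {R : Type*} [CommRing R] [IsLocalRing R]

theorem IsLocalRing.span_range_comp_eq_maximalIdeal {S : Type*} [CommRing S] [IsLocalRing S]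
    (f : R →+* S) (hf : Function.Surjective f) {ι : Type*} {y : ι → R}
    (hy : Ideal.span (Set.range y) = maximalIdeal R) :
    Ideal.span (Set.range (f ∘ y)) = maximalIdeal S := by
  rw [Set.range_comp, ← Ideal.map_span, hy, map_maximalIdeal_of_surjective f hf]

theorem ringKrullDim_le_of_span_range_eq_maximalIdeal [IsNoetherianRing R] {n : ℕ} {y : Fin n → R}
    (hy : Ideal.span (Set.range y) = maximalIdeal R) : ringKrullDim R ≤ n := by
  refine (ringKrullDim_le_spanFinrank_maximalIdeal R).trans ?_
  have h := Submodule.spanFinrank_span_le_ncard_of_finite (R := R) (Set.finite_range y)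
  have h2 : (Set.range y).ncard ≤ n := by
    rw [← Set.image_univ]
    exact (Set.ncard_image_le Set.finite_univ).trans (by simp)
  have h3 : (maximalIdeal R).spanFinrank ≤ n := by
    rw [← hy]; exact h.trans h2
  exact_mod_cast h3

theorem le_ringKrullDim_quotient_span_singleton [IsNoetherianRing R] {n : ℕ}
    (h : (n + 1 : ℕ) ≤ ringKrullDim R) {x : R} (hx : x ∈ maximalIdeal R) :
    n ≤ ringKrullDim (R ⧸ Ideal.span {x}) := by
  have h1 := ringKrullDim_le_ringKrullDim_quotient_add_card (R := R) {x} (by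
    simpa [IsLocalRing.ringJacobson_eq_maximalIdeal] using hx)
  rw [Finset.coe_singleton, Finset.card_singleton] at h1
  have h2 := h.trans h1
  push_cast at h2
  exact (ENat.WithBot.add_le_add_one_right_iff).mp h2

theorem IsLocalRing.quotient_span_singleton {x : R} (hx : x ∈ maximalIdeal R) :
    IsLocalRing (R ⧸ Ideal.span {x}) := by
  have : Nontrivial (R ⧸ Ideal.span {x}) := by
    rw [Ideal.Quotient.nontrivial_iff]
    intro h
    rw [Ideal.span_singleton_eq_top] at h
    exact hx h
  exact .of_surjective' _ Ideal.Quotient.mk_surjective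

theorem span_range_mk_succAbove {n : ℕ} {y : Fin (n + 1) → R}
    (hy : Ideal.span (Set.range y) = maximalIdeal R) (k : Fin (n + 1))
    [IsLocalRing (R ⧸ Ideal.span {y k})] :
    Ideal.span (Set.range fun i => Ideal.Quotient.mk (Ideal.span {y k}) (y (k.succAbove i))) =
      maximalIdeal (R ⧸ Ideal.span {y k}) := by
  rw [← span_range_comp_eq_maximalIdeal _ Ideal.Quotient.mk_surjective hy]
  apply le_antisymm
  · apply Ideal.span_mono
    rintro _ ⟨i, rfl⟩
    exact ⟨_, rfl⟩
  · rw [Ideal.span_le]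
    rintro _ ⟨i, rfl⟩
    induction i using Fin.succAboveCases k with
    | x =>
      have : Ideal.Quotient.mk (Ideal.span {y k}) (y k) = 0 :=
        Ideal.Quotient.eq_zero_iff_mem.mpr (Ideal.mem_span_singleton_self _)
      simp [this]
    | p i => exact Ideal.subset_span ⟨i, rfl⟩

end RegularDomain

/-- Induction on the number of parameters: `R ⧸ (y 0)` is a domain. A prime `p` with `R ⧸ p` of
dimension at least `n + 1` cannot contain `y 0`, must lie in `(y 0)`, and then vanishes by Nakayama.
-/
theorem isDomain_of_span_range_eq_maximalIdeal (n : ℕ) :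
    ∀ (R : Type*) [CommRing R] [IsLocalRing R] [IsNoetherianRing R] (y : Fin n → R),
    Ideal.span (Set.range y) = maximalIdeal R → n ≤ ringKrullDim R → IsDomain R := by
  induction n with
  | zero =>
    intro R _ _ _ y hy _
    have : maximalIdeal R = ⊥ := by rw [← hy]; simp
    exact (isField_iff_maximalIdeal_eq.mpr this).isDomain
  | succ n ih =>
    intro R _ _ _ y hy hn
    have hmem : ∀ k, y k ∈ maximalIdeal R := fun k => hy ▸ Ideal.subset_span ⟨k, rfl⟩
    have := IsLocalRing.quotient_span_singleton (hmem 0)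
    have hB := ih (R ⧸ Ideal.span {y 0}) _ (span_range_mk_succAbove hy 0)
      (le_ringKrullDim_quotient_span_singleton hn (hmem 0))
    have hdimB := ringKrullDim_le_of_span_range_eq_maximalIdeal (span_range_mk_succAbove hy 0)
    obtain ⟨p, hp, hdp⟩ := exists_isPrime_le_ringKrullDim_quotient (n + 1) hn
    have : IsLocalRing (R ⧸ p) := .of_surjective' _ Ideal.Quotient.mk_surjective
    have hyp := IsLocalRing.span_range_comp_eq_maximalIdeal (Ideal.Quotient.mk p)
      Ideal.Quotient.mk_surjective hy
    set x := Ideal.Quotient.mk p (y 0) with hxdef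
    have hxm : x ∈ maximalIdeal (R ⧸ p) := hyp ▸ Ideal.subset_span ⟨0, rfl⟩
    have hCn := le_ringKrullDim_quotient_span_singleton hdp hxm
    have := IsLocalRing.quotient_span_singleton hxm
    -- the element `y 0` is not in `p`
    have hx0 : y 0 ∉ p := by
      intro h
      have hx : x = 0 := Ideal.Quotient.eq_zero_iff_mem.mpr h
      have h1 : ringKrullDim (R ⧸ p) ≤ n := by
        refine ringKrullDim_le_of_span_range_eq_maximalIdeal
          (y := fun i : Fin n => Ideal.Quotient.mk p (y i.succ)) ?_
        rw [← hyp]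
        apply le_antisymm
        · apply Ideal.span_mono
          rintro _ ⟨i, rfl⟩
          exact ⟨_, rfl⟩
        · rw [Ideal.span_le]
          rintro _ ⟨i, rfl⟩
          induction i using Fin.cases with
          | zero => simp [← hxdef, hx]
          | succ i => exact Ideal.subset_span ⟨i, rfl⟩
      have h2 := hdp.trans h1
      norm_cast at h2
      omega
    -- the ideal `p` is contained in `(y 0)`
    have hpx : p ≤ Ideal.span {y 0} := by
      intro z hz
      by_contra hzx
      -- Killing the nonzerodivisor `z` in the domain `R ⧸ (y 0)`, of dimension at most `n`, lowers
      -- the dimension; but `R ⧸ (p + (y 0))` is a further quotient and has dimension at least `n`.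
      let g : (R ⧸ Ideal.span {y 0}) ⧸ Ideal.span {Ideal.Quotient.mk (Ideal.span {y 0}) z} →+*
          R ⧸ (p ⊔ Ideal.span {y 0}) := Ideal.Quotient.lift _ (Ideal.Quotient.factor le_sup_right)
            (by
              intro a ha
              obtain ⟨b, rfl⟩ := Ideal.mem_span_singleton'.mp ha
              rw [map_mul, Ideal.Quotient.factor_mk,
                Ideal.Quotient.eq_zero_iff_mem.mpr (Ideal.mem_sup_left hz), mul_zero])
      have hg : Function.Surjective g :=
        Ideal.Quotient.lift_surjective_of_surjective _ _ (Ideal.Quotient.factor_surjective _)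
      have h1 := ringKrullDim_le_of_surjective g hg
      have h2 := ringKrullDim_quotient_succ_le_of_nonZeroDivisor
        (r := Ideal.Quotient.mk (Ideal.span {y 0}) z) (by
          rw [mem_nonZeroDivisors_iff_ne_zero]
          exact fun h => hzx (Ideal.Quotient.eq_zero_iff_mem.mp h))
      have h3 : ringKrullDim ((R ⧸ p) ⧸ Ideal.span {x}) =
          ringKrullDim (R ⧸ (p ⊔ Ideal.span {y 0})) := by
        have := DoubleQuot.quotQuotEquivQuotSup p (Ideal.span {y 0})
        rw [Ideal.map_span, Set.image_singleton] at this
        exact ringKrullDim_eq_of_ringEquiv this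
      rw [h3] at hCn
      have h4 := (add_le_add_left (hCn.trans h1) 1).trans (h2.trans hdimB)
      have h5 : n + 1 ≤ n := by exact_mod_cast h4
      omega
    -- An element `a * y 0` of `p` has `a ∈ p`, since `y 0 ∉ p`; so `p ≤ m • p`.
    have hp0 : p = ⊥ := by
      refine Submodule.eq_bot_of_le_smul_of_le_jacobson_bot (maximalIdeal R) p
        (IsNoetherian.noetherian p) ?_ (IsLocalRing.maximalIdeal_le_jacobson _)
      intro z hz
      obtain ⟨a, rfl⟩ := Ideal.mem_span_singleton'.mp (hpx hz)
      rw [mul_comm]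
      exact Submodule.smul_mem_smul (hmem 0) ((hp.mem_or_mem hz).resolve_right hx0)
    subst hp0
    exact IsDomain.of_bot_isPrime R

/-- The quotient by `y k` has one parameter less and dimension at least one less than `d`, so it is
again a domain. This replaces unique factorization in what follows. -/
theorem prime_of_span_range_eq_maximalIdeal {R : Type*} [CommRing R] [IsLocalRing R]
    [IsNoetherianRing R] {d : ℕ} {y : Fin d → R} (hy : Ideal.span (Set.range y) = maximalIdeal R)
    (hd : d ≤ ringKrullDim R) (k : Fin d) : Prime (y k) := by
  obtain _ | n := d
  · exact k.elim0
  have hmem : y k ∈ maximalIdeal R := hy ▸ Ideal.subset_span ⟨k, rfl⟩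
  have := IsLocalRing.quotient_span_singleton hmem
  have hspan := span_range_mk_succAbove hy k
  have hk : y k ≠ 0 := by
    intro hk
    have h1 := ringKrullDim_le_of_span_range_eq_maximalIdeal hspan
    have h2 : ringKrullDim (R ⧸ Ideal.span {y k}) = ringKrullDim R := by
      have h : Ideal.span {y k} = ⊥ := by rw [hk, Ideal.span_singleton_eq_bot]
      exact ringKrullDim_eq_of_ringEquiv ((Ideal.quotEquivOfEq h).trans (RingEquiv.quotientBot R))
    rw [h2] at h1
    have h3 : n + 1 ≤ n := by exact_mod_cast hd.trans h1
    omega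
  rw [← Ideal.span_singleton_prime hk, ← Ideal.Quotient.isDomain_iff_prime]
  exact isDomain_of_span_range_eq_maximalIdeal n _ _ hspan
    (le_ringKrullDim_quotient_span_singleton hd hmem)

/-! ### Lengths of quotients and an Abhyankar inequality. -/

section Length

variable {B : Type*} [CommRing B]

/-- The kernel of `B ⧸ (J, x * y) → B ⧸ (J, x)` is the image of `B ⧸ (J, y)` under multiplication by
`x`. -/
theorem length_quotient_sup_span_mul_le (J : Ideal B) (x y : B) :
    Module.length B (B ⧸ (J ⊔ Ideal.span {x * y})) ≤
      Module.length B (B ⧸ (J ⊔ Ideal.span {x})) +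
        Module.length B (B ⧸ (J ⊔ Ideal.span {y})) := by
  have hle : J ⊔ Ideal.span {x * y} ≤ J ⊔ Ideal.span {x} :=
    sup_le_sup_left (Ideal.span_singleton_le_span_singleton.mpr (Dvd.intro _ rfl)) _
  let g := Submodule.factor hle
  have hg : Function.Surjective g := Submodule.factor_surjective hle
  rw [Module.length_eq_add_of_exact (LinearMap.ker g).subtype g (Submodule.subtype_injective _) hg
    (LinearMap.exact_subtype_ker_map g), add_comm]
  refine add_le_add le_rfl ?_
  let m : B →ₗ[B] (B ⧸ (J ⊔ Ideal.span {x * y})) :=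
    LinearMap.toSpanSingleton B _ (Submodule.Quotient.mk x)
  have hm : ∀ b, m b = Submodule.Quotient.mk (b * x) := fun b => rfl
  have hker : J ⊔ Ideal.span {y} ≤ LinearMap.ker m := by
    refine sup_le ?_ ?_
    · intro b hb
      rw [LinearMap.mem_ker, hm, Submodule.Quotient.mk_eq_zero]
      exact Ideal.mem_sup_left (J.mul_mem_right _ hb)
    · rw [Ideal.span_singleton_le_iff_mem, LinearMap.mem_ker, hm,
        Submodule.Quotient.mk_eq_zero, mul_comm]
      exact Ideal.mem_sup_right (Ideal.mem_span_singleton_self _)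
  let q : (B ⧸ (J ⊔ Ideal.span {y})) →ₗ[B] (B ⧸ (J ⊔ Ideal.span {x * y})) :=
    Submodule.liftQ _ m hker
  have hq : LinearMap.range q = LinearMap.ker g := by
    rw [Submodule.range_liftQ]
    apply le_antisymm
    · rintro _ ⟨b, rfl⟩
      rw [LinearMap.mem_ker, hm]
      change Submodule.Quotient.mk (b * x) = _
      rw [Submodule.Quotient.mk_eq_zero]
      exact Ideal.mem_sup_right (Ideal.mem_span_singleton'.mpr ⟨b, rfl⟩)
    · intro z hz
      obtain ⟨z, rfl⟩ := Submodule.Quotient.mk_surjective _ z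
      have hz' : z ∈ J ⊔ Ideal.span {x} := by
        rw [← Submodule.Quotient.mk_eq_zero]; exact hz
      obtain ⟨a, ha, c, hc, rfl⟩ := Submodule.mem_sup.mp hz'
      obtain ⟨b, rfl⟩ := Ideal.mem_span_singleton'.mp hc
      refine ⟨b, ?_⟩
      rw [hm, Submodule.Quotient.eq]
      have : b * x - (a + b * x) = -a := by ring
      rw [this]
      exact neg_mem (Ideal.mem_sup_left ha)
  rw [← hq]
  exact Module.length_le_of_surjective q.rangeRestrict q.surjective_rangeRestrict

theorem length_quotient_sup_span_pow_le (J : Ideal B) (x : B) (N : ℕ) :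
    Module.length B (B ⧸ (J ⊔ Ideal.span {x ^ N})) ≤
      N * Module.length B (B ⧸ (J ⊔ Ideal.span {x})) := by
  induction N with
  | zero =>
    have : J ⊔ Ideal.span {x ^ 0} = ⊤ := by simp
    have : Subsingleton (B ⧸ (J ⊔ Ideal.span {x ^ 0})) :=
      Ideal.Quotient.subsingleton_iff.mpr this
    simp [Module.length_eq_zero]
  | succ N ih =>
    rw [pow_succ]
    refine (length_quotient_sup_span_mul_le J _ _).trans ?_
    push_cast
    rw [add_mul, one_mul]
    gcongr

/-- Generators are replaced by their powers one at a time, each costing a factor `N`. The ideal `J`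
varies so that it can absorb the powers already introduced. -/
theorem length_quotient_sup_span_image_pow_le [DecidableEq B] (N : ℕ) (s : Finset B) :
    ∀ J : Ideal B, Module.length B (B ⧸ (J ⊔ Ideal.span ((· ^ N) '' (s : Set B)))) ≤
      (N : ℕ∞) ^ s.card * Module.length B (B ⧸ (J ⊔ Ideal.span (s : Set B))) := by
  induction s using Finset.induction_on with
  | empty =>
    intro J
    rw [Finset.coe_empty, Set.image_empty]
    simp
  | insert x s hx ih =>
    intro J
    rw [Finset.coe_insert, Set.image_insert_eq, Ideal.span_insert, Ideal.span_insert,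
      ← sup_assoc, ← sup_assoc, Finset.card_insert_of_notMem hx]
    refine (ih _).trans ?_
    rw [pow_succ, mul_assoc]
    gcongr
    have h := length_quotient_sup_span_pow_le (J ⊔ Ideal.span (s : Set B)) x N
    rwa [sup_right_comm, sup_right_comm J (Ideal.span (s : Set B))] at h

/-- The ideals `{v ≤ γ}` for `γ ∈ Z` contain `I` and have pairwise distinct images in `B ⧸ I`. A
chain through `n + 1` values has only `n` strict steps, whence the added one. -/
theorem card_le_length_quotient_add_one {Γ₀ : Type*} [LinearOrderedCommGroupWithZero Γ₀]
    (v : Valuation B Γ₀) (hv : ∀ b, v b ≤ 1) (I : Ideal B) (Z : Finset Γ₀)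
    (hZ : ∀ γ ∈ Z, ∃ z, v z = γ) (hI : ∀ γ ∈ Z, ∀ x ∈ I, v x ≤ γ) :
    (Z.card : ℕ∞) ≤ Module.length B (B ⧸ I) + 1 := by
  obtain hc | ⟨n, hc⟩ : Z.card = 0 ∨ ∃ n, Z.card = n + 1 := by
    cases h : Z.card <;> simp
  · simp [hc]
  let J : Γ₀ → Ideal B := fun γ =>
    { carrier := {z | v z ≤ γ}
      add_mem' := fun ha hb => v.map_add_le ha hb
      zero_mem' := by simp
      smul_mem' := fun c z hz => by
        simp only [smul_eq_mul, Set.mem_ofPred_eq, map_mul] at hz ⊢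
        exact (mul_le_of_le_one_left' (hv c)).trans hz }
  let e := Z.orderEmbOfFin hc
  have he : ∀ i, e i ∈ Z := fun i => Z.orderEmbOfFin_mem hc i
  let l : LTSeries (Submodule B (B ⧸ I)) := LTSeries.mk n
    (fun i => Submodule.map I.mkQ (J (e i))) (by
      intro i j hij
      have hlt := e.strictMono hij
      refine lt_of_le_of_ne (Submodule.map_mono fun z hz => le_trans hz hlt.le) ?_
      intro heq
      dsimp only at heq
      obtain ⟨z, hz⟩ := hZ _ (he j)
      have h1 : I.mkQ z ∈ Submodule.map I.mkQ (J (e j)) := Submodule.mem_map_of_mem (hz.le)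
      rw [← heq] at h1
      obtain ⟨z', hz', h2⟩ := h1
      have h3 : z' - z ∈ I := by
        rwa [Submodule.mkQ_apply, Submodule.mkQ_apply, Submodule.Quotient.eq] at h2
      have h4 : v z ≤ e i := by
        have : z = z' - (z' - z) := by ring
        rw [this]
        exact v.map_sub_le hz' (hI _ (he i) _ h3)
      rw [hz] at h4
      exact absurd h4 (not_le.mpr hlt))
  have h := Order.LTSeries.length_le_krullDim l
  rw [← Module.coe_length] at h
  have h' : (n : ℕ∞) ≤ Module.length B (B ⧸ I) := by exact_mod_cast h
  rw [hc]
  push_cast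
  gcongr

/-- The quotient is Noetherian of dimension zero, hence Artinian. -/
theorem length_quotient_ne_top_of_mem_minimalPrimes [IsLocalRing B] [IsNoetherianRing B]
    {I : Ideal B} (h : maximalIdeal B ∈ I.minimalPrimes) : Module.length B (B ⧸ I) ≠ ⊤ := by
  have : Ring.KrullDimLE 0 (B ⧸ I) := by
    rw [Ring.krullDimLE_zero_iff]
    intro p hp
    have h1 : maximalIdeal B ≤ p.comap (Ideal.Quotient.mk I) :=
      h.2 ⟨inferInstance, by
        intro x hx
        rw [Ideal.mem_comap, Ideal.Quotient.eq_zero_iff_mem.mpr hx]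
        exact zero_mem _⟩ (le_maximalIdeal (Ideal.IsPrime.ne_top inferInstance))
    have h2 : (p.comap (Ideal.Quotient.mk I)).IsMaximal := by
      rw [← (maximalIdeal.isMaximal B).eq_of_le (Ideal.IsPrime.ne_top inferInstance) h1]
      infer_instance
    have h3 := Ideal.map_comap_of_surjective _ Ideal.Quotient.mk_surjective p
    have h4 := Ideal.map_eq_top_or_isMaximal_of_surjective (Ideal.Quotient.mk I)
      Ideal.Quotient.mk_surjective h2
    rw [h3] at h4
    exact h4.resolve_left hp.ne_top
  have := IsNoetherianRing.isArtinianRing_of_krullDimLE_zero (R := B ⧸ I)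
  rw [Module.length_eq_of_surjective (R := B ⧸ I) Ideal.Quotient.mk_surjective]
  exact Module.length_ne_top

/-- An inequality of Abhyankar type: if a valuation that is nonnegative on a Noetherian local ring
takes distinct values on the monomials in `f 0, …, f (d - 1)`, and the value of their product is
bounded by multiples of the value of every element of the maximal ideal, then the ring has
dimension at least `d`. -/
theorem le_ringKrullDim_of_injective_valuation_monomials [IsLocalRing B] [IsNoetherianRing B]
    {Γ₀ : Type*} [LinearOrderedCommGroupWithZero Γ₀] (v : Valuation B Γ₀) (hv : ∀ b, v b ≤ 1)
    {d : ℕ} (f : Fin d → B)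
    (hf : Function.Injective fun a : Fin d → ℕ => v (∏ i, f i ^ a i))
    (harch : ∀ x ∈ maximalIdeal B, ∃ c : ℕ, v x ^ c < v (∏ i, f i)) :
    d ≤ ringKrullDim B := by
  classical
  obtain ⟨s, hs, hcard⟩ :=
    Ideal.exists_finset_card_eq_height_of_isNoetherianRing (maximalIdeal B)
  rw [← maximalIdeal_height_eq_ringKrullDim, ← hcard]
  suffices d ≤ s.card by exact_mod_cast this
  by_contra! hlt
  obtain ⟨ℓ, hℓ⟩ := ENat.ne_top_iff_exists.mp (length_quotient_ne_top_of_mem_minimalPrimes hs)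
  have hsm : ∀ x ∈ s, x ∈ maximalIdeal B := fun x hx => hs.1.2 (Ideal.subset_span hx)
  set F := ∏ i, f i with hF
  obtain ⟨c, hc⟩ : ∃ c : ℕ, ∀ x ∈ s, v x ^ c < v F := by
    choose! c hc using harch
    refine ⟨s.sup c, fun x hx => lt_of_le_of_lt ?_ (hc x (hsm x hx))⟩
    exact pow_le_pow_right_of_le_one' (hv x) (Finset.le_sup hx)
  have hF0 : v F ≠ 0 := by
    obtain ⟨c', hc'⟩ := harch 0 (zero_mem _)
    exact (lt_of_le_of_lt zero_le hc').ne'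
  -- The monomials with exponents at most `N + 1` have `(N + 2) ^ d` distinct values, all at least
  -- `v F ^ (N + 1)`. The powers `x ^ (c * (N + 1))` of the parameters `x ∈ s` have values at most
  -- that, so the length of the quotient by them bounds the count.
  have key : ∀ N : ℕ, (N + 2) ^ d ≤ (c * (N + 1)) ^ s.card * ℓ + 1 := by
    intro N
    let T : Finset (Fin d → ℕ) := Fintype.piFinset fun _ => Finset.range (N + 2)
    let I := Ideal.span ((· ^ (c * (N + 1))) '' (s : Set B))
    have hI : ∀ x ∈ I, v x ≤ v F ^ (N + 1) := by
      let J : Ideal B :=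
        { carrier := {z | v z ≤ v F ^ (N + 1)}
          add_mem' := fun ha hb => v.map_add_le ha hb
          zero_mem' := by simp
          smul_mem' := fun c z hz => by
            simp only [smul_eq_mul, Set.mem_ofPred_eq, map_mul] at hz ⊢
            exact (mul_le_of_le_one_left' (hv c)).trans hz }
      have : I ≤ J := by
        rw [Ideal.span_le]
        rintro _ ⟨x, hx, rfl⟩
        change v (x ^ _) ≤ _
        rw [map_pow, pow_mul]
        exact pow_le_pow_left' (hc x hx).le _
      exact this
    have h1 := card_le_length_quotient_add_one v hv I
      (T.image fun a => v (∏ i, f i ^ a i)) (by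
        intro γ hγ
        obtain ⟨a, -, rfl⟩ := Finset.mem_image.mp hγ
        exact ⟨_, rfl⟩) (by
        intro γ hγ x hx
        obtain ⟨a, ha, rfl⟩ := Finset.mem_image.mp hγ
        refine (hI x hx).trans ?_
        rw [hF, map_prod, map_prod, ← Finset.prod_pow]
        refine Finset.prod_le_prod' fun i _ => ?_
        rw [map_pow]
        refine pow_le_pow_right_of_le_one' (hv _) ?_
        have := Finset.mem_range.mp (Fintype.mem_piFinset.mp ha i)
        omega)
    rw [Finset.card_image_of_injective _ hf, Fintype.card_piFinset] at h1
    have h2 := length_quotient_sup_span_image_pow_le (c * (N + 1)) s (⊥ : Ideal B)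
    rw [bot_sup_eq, bot_sup_eq, ← hℓ] at h2
    have h3 := h1.trans (add_le_add_left h2 1)
    simp only [Finset.card_range, Finset.prod_const, Finset.card_univ, Fintype.card_fin] at h3
    exact_mod_cast h3
  -- The left side of `key` grows with degree `d > s.card` and the right side with degree at most
  -- `s.card`. For this `N` the bound reads `(N + 2) ^ d ≤ N * (N + 1) ^ s.card + 1`, which is
  -- already false.
  have h := key (c ^ s.card * ℓ)
  set N := c ^ s.card * ℓ with hN
  have h1 : (N + 2) ^ (s.card + 1) ≤ (N + 2) ^ d := Nat.pow_le_pow_right (by omega) hlt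
  have h2 : (c * (N + 1)) ^ s.card * ℓ = N * (N + 1) ^ s.card := by rw [mul_pow, hN]; ring
  have h3 : (N + 1) ^ s.card ≤ (N + 2) ^ s.card := Nat.pow_le_pow_left (by omega) _
  have h4 : 1 ≤ (N + 2) ^ s.card := Nat.one_le_pow _ _ (by omega)
  rw [h2] at h
  rw [pow_succ] at h1
  nlinarith

end Length

/-! ### Local rings dominated by `V` and generators of their maximal ideals. -/

/-- Ideals of varying subrings become submodules of the fixed field `K`, so that generators can be
kept as elements of `K`. -/
theorem Subring.coe_mem_span_range_iff {K : Type*} [Field K] (C : Subring K) {ι : Type*}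
    (y : ι → C) (z : C) :
    (z : K) ∈ Submodule.span C (Set.range fun i => (y i : K)) ↔ z ∈ Ideal.span (Set.range y) := by
  have h : Submodule.span C (Set.range fun i => (y i : K)) =
      Submodule.map (Algebra.linearMap C K) (Submodule.span C (Set.range y)) := by
    rw [Submodule.map_span, ← Set.range_comp]
    rfl
  rw [h]
  constructor
  · rintro ⟨x, hx, hxz⟩
    rwa [← Subtype.ext (a1 := x) (a2 := z) hxz]
  · intro hz
    exact ⟨z, hz, rfl⟩

namespace ValuationSubring

variable {K : Type*} [Field K] (V : ValuationSubring K)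

/-- The subring `B` of `K` is contained in `V`, and its elements that are units of `V`
are units of `B`. -/
def Dominates (B : Subring K) : Prop :=
  B ≤ V.toSubring ∧ ∀ s ∈ B, V.valuation s = 1 → s⁻¹ ∈ B

/-- The localization of a subring `C` of `K` at the elements of value `1`. -/
def hull (C : Subring K) : Subring K where
  carrier := {z | ∃ x ∈ C, ∃ s ∈ C, V.valuation s = 1 ∧ z = x / s}
  mul_mem' := by
    rintro _ _ ⟨x, hx, s, hs, hvs, rfl⟩ ⟨y, hy, t, ht, hvt, rfl⟩
    exact ⟨x * y, C.mul_mem hx hy, s * t, C.mul_mem hs ht, by rw [map_mul, hvs, hvt, one_mul],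
      div_mul_div_comm _ _ _ _⟩
  one_mem' := ⟨1, C.one_mem, 1, C.one_mem, map_one _, by simp⟩
  add_mem' := by
    rintro _ _ ⟨x, hx, s, hs, hvs, rfl⟩ ⟨y, hy, t, ht, hvt, rfl⟩
    have hs0 : s ≠ 0 := fun h => by simp [h] at hvs
    have ht0 : t ≠ 0 := fun h => by simp [h] at hvt
    exact ⟨x * t + s * y, C.add_mem (C.mul_mem hx ht) (C.mul_mem hs hy), s * t, C.mul_mem hs ht,
      by rw [map_mul, hvs, hvt, one_mul], div_add_div _ _ hs0 ht0⟩
  zero_mem' := ⟨0, C.zero_mem, 1, C.one_mem, map_one _, by simp⟩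
  neg_mem' := by
    rintro _ ⟨x, hx, s, hs, hvs, rfl⟩
    exact ⟨-x, C.neg_mem hx, s, hs, hvs, by rw [neg_div]⟩

variable {V}

theorem mem_hull {C : Subring K} {z : K} :
    z ∈ V.hull C ↔ ∃ x ∈ C, ∃ s ∈ C, V.valuation s = 1 ∧ z = x / s := Iff.rfl

theorem le_hull (C : Subring K) : C ≤ V.hull C :=
  fun x hx => ⟨x, hx, 1, C.one_mem, map_one _, by simp⟩

theorem hull_le {C D : Subring K} (h : C ≤ D) (hD : V.Dominates D) : V.hull C ≤ D := by
  rintro _ ⟨x, hx, s, hs, hvs, rfl⟩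
  rw [div_eq_mul_inv]
  exact D.mul_mem (h hx) (hD.2 s (h hs) hvs)

theorem dominates_hull {C : Subring K} (h : C ≤ V.toSubring) : V.Dominates (V.hull C) := by
  refine ⟨?_, ?_⟩
  · rintro _ ⟨x, hx, s, hs, hvs, rfl⟩
    change _ ∈ V
    rw [← V.valuation_le_one_iff, map_div₀, hvs, div_one, V.valuation_le_one_iff]
    exact h hx
  · rintro _ ⟨x, hx, s, hs, hvs, rfl⟩ hv
    rw [map_div₀, hvs, div_one] at hv
    exact ⟨s, hs, x, hx, hv, by rw [inv_div]⟩

theorem Dominates.valuation_le_one {B : Subring K} (hB : V.Dominates B) {x : K} (hx : x ∈ B) :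
    V.valuation x ≤ 1 := (V.valuation_le_one_iff x).mpr (hB.1 hx)

theorem Dominates.isUnit_iff {B : Subring K} (hB : V.Dominates B) (x : B) :
    IsUnit x ↔ V.valuation (x : K) = 1 := by
  constructor
  · rintro ⟨u, rfl⟩
    refine le_antisymm (hB.valuation_le_one (u : B).2) ?_
    have h : ((u : B) : K) * ((u⁻¹ : Bˣ) : B) = 1 := by
      rw [← Subring.coe_mul, Units.mul_inv, Subring.coe_one]
    rw [← map_one V.valuation, ← h, map_mul]
    exact mul_le_of_le_one_right' (hB.valuation_le_one ((u⁻¹ : Bˣ) : B).2)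
  · intro h
    have h0 : (x : K) ≠ 0 := fun h0 => by simp [h0] at h
    exact IsUnit.of_mul_eq_one ⟨(x : K)⁻¹, hB.2 _ x.2 h⟩ (Subtype.ext (mul_inv_cancel₀ h0))

theorem Dominates.isLocalRing {B : Subring K} (hB : V.Dominates B) : IsLocalRing B := by
  refine .of_nonunits_add fun a b ha hb => ?_
  rw [_root_.mem_nonunits_iff, hB.isUnit_iff] at ha hb ⊢
  refine (lt_of_le_of_lt (V.valuation.map_add _ _) (max_lt ?_ ?_)).ne
  · exact lt_of_le_of_ne (hB.valuation_le_one a.2) ha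
  · exact lt_of_le_of_ne (hB.valuation_le_one b.2) hb

theorem Dominates.mem_maximalIdeal_iff {B : Subring K} (hB : V.Dominates B) [IsLocalRing B]
    (x : B) : x ∈ maximalIdeal B ↔ V.valuation (x : K) < 1 := by
  rw [mem_maximalIdeal, _root_.mem_nonunits_iff, hB.isUnit_iff]
  exact (hB.valuation_le_one x.2).lt_iff_ne.symm

theorem dominates_of_le {A : LocalSubring K} (h : A ≤ V.toLocalSubring) :
    V.Dominates A.toSubring := by
  obtain ⟨hle, hloc⟩ := h
  refine ⟨hle, fun s hs hvs => ?_⟩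
  have h1 : IsUnit (Subring.inclusion hle ⟨s, hs⟩) :=
    (V.valuation_eq_one_iff ⟨s, hle hs⟩).mpr hvs
  obtain ⟨t, ht⟩ := isUnit_iff_exists_inv.mp (hloc.map_nonunit _ h1)
  have h2 : s * (t : K) = 1 := congrArg Subtype.val ht
  rw [inv_eq_of_mul_eq_one_right h2]
  exact t.2

/-- The elements of `G` lie in `B`, have value less than `1` and generate the ideal of such elements
of `B`. -/
def Generates (V : ValuationSubring K) (B : Subring K) (G : Set K) : Prop :=
  (∀ g ∈ G, g ∈ B ∧ V.valuation g < 1) ∧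
    ∀ z ∈ B, V.valuation z < 1 → z ∈ Submodule.span B G

theorem span_le_span {B C : Subring K} (h : B ≤ C) {G H : Set K} (hGH : G ⊆ H) {z : K}
    (hz : z ∈ Submodule.span B G) : z ∈ Submodule.span C H := by
  induction hz using Submodule.span_induction with
  | mem x hx => exact Submodule.subset_span (hGH hx)
  | zero => exact Submodule.zero_mem _
  | add x y _ _ hx hy => exact Submodule.add_mem _ hx hy
  | smul a x _ hx =>
    exact (Submodule.span C H).smul_mem (⟨a, h a.2⟩ : C) hx

/-- Adjoining one element to a local ring dominated by `V` and localizing at the center of `V`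
adds one generator to the maximal ideal. -/
theorem Generates.exists_hull_adjoin {B : Subring K} (hB : V.Dominates B) {G : Set K}
    (hG : V.Generates B G) {y : K} (hy : y ∈ V) :
    ∃ g : K, (V.valuation y < 1 → g = y) ∧
      V.Generates (V.hull (Algebra.adjoin B {y}).toSubring) (insert g G) := by
  have := hB.isLocalRing
  set C := (Algebra.adjoin B {y}).toSubring with hC
  have hmemC : ∀ z : K, z ∈ C ↔ ∃ F : Polynomial B, Polynomial.aeval y F = z := by
    intro z
    change z ∈ Algebra.adjoin B {y} ↔ _
    rw [Algebra.adjoin_singleton_eq_range_aeval]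
    rfl
  have hBC : B ≤ C := fun b hb => (Algebra.adjoin B {y}).algebraMap_mem ⟨b, hb⟩
  have hyC : y ∈ C := Algebra.subset_adjoin rfl
  have hCV : C ≤ V.toSubring := by
    intro z hz
    obtain ⟨F, rfl⟩ := (hmemC z).mp hz
    rw [Polynomial.aeval_eq_sum_range]
    refine sum_mem fun i _ => V.toSubring.mul_mem (hB.1 (F.coeff i).2) (V.toSubring.pow_mem hy i)
  have hval : ∀ F : Polynomial B, V.valuation (Polynomial.aeval y F) ≤ 1 := fun F =>
    (V.valuation_le_one_iff _).mpr (hCV ((hmemC _).mpr ⟨F, rfl⟩))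
  -- it is enough to treat the elements of `B[y]`
  suffices h : ∃ g ∈ C, V.valuation g < 1 ∧ (V.valuation y < 1 → g = y) ∧ ∀ F : Polynomial B,
      V.valuation (Polynomial.aeval y F) < 1 →
        Polynomial.aeval y F ∈ Submodule.span C (insert g G) by
    obtain ⟨g, hgC, hg1, hgy, hg⟩ := h
    refine ⟨g, hgy, ?_, ?_⟩
    · rintro z (rfl | hz)
      · exact ⟨le_hull _ hgC, hg1⟩
      · exact ⟨le_hull _ (hBC (hG.1 z hz).1), (hG.1 z hz).2⟩
    · rintro _ ⟨x, hx, s, hs, hvs, rfl⟩ hv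
      rw [map_div₀, hvs, div_one] at hv
      obtain ⟨F, rfl⟩ := (hmemC x).mp hx
      have h1 := span_le_span (le_hull (V := V) C) subset_rfl (hg F hv)
      have h2 : s⁻¹ ∈ V.hull C := (dominates_hull hCV).2 s (le_hull _ hs) hvs
      rw [div_eq_inv_mul]
      exact Submodule.smul_mem _ (⟨s⁻¹, h2⟩ : V.hull C) h1
  by_cases hy1 : V.valuation y < 1
  -- Here `F(y)` is a multiple of `y` plus the constant coefficient, which then also has value less
  -- than `1`. Taking `g = y` is what later identifies the new variables with quotients of old ones.
  · refine ⟨y, hyC, hy1, fun _ => rfl, fun F hF => ?_⟩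
    rw [← Polynomial.divX_mul_X_add F] at hF ⊢
    simp only [map_add, map_mul, Polynomial.aeval_X, Polynomial.aeval_C] at hF ⊢
    refine Submodule.add_mem _ ?_
      (span_le_span hBC (Set.subset_insert _ _) (hG.2 _ (F.coeff 0).2 ?_))
    · exact Submodule.smul_mem _ (⟨_, (hmemC _).mpr ⟨F.divX, rfl⟩⟩ : C)
        (Submodule.subset_span (Set.mem_insert _ _))
    · have h1 : V.valuation (Polynomial.aeval y F.divX * y) < 1 := by
        rw [map_mul]
        exact lt_of_le_of_lt (mul_le_of_le_one_left' (hval _)) hy1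
      have h2 := V.valuation.map_sub_lt hF h1
      rwa [add_sub_cancel_left] at h2
  -- Now `y` is a unit of `V`. The image of `P` in the polynomial ring over the residue field is
  -- principal. A lift `p` of its generator gives `g = p(y)`, as every `F ∈ P` is a multiple of `p`
  -- up to coefficients in the maximal ideal of `B`.
  · let P : Ideal (Polynomial B) :=
      { carrier := {F | V.valuation (Polynomial.aeval y F) < 1}
        add_mem' := fun {a b} ha hb => by
          simp only [Set.mem_ofPred_eq, map_add] at ha hb ⊢
          exact V.valuation.map_add_lt ha hb
        zero_mem' := by simp
        smul_mem' := fun c z hz => by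
          simp only [smul_eq_mul, Set.mem_ofPred_eq, map_mul] at hz ⊢
          exact lt_of_le_of_lt (mul_le_of_le_one_left' (hval _)) hz }
    let f : Polynomial B →+* Polynomial (ResidueField B) := Polynomial.mapRingHom (residue B)
    have hf : Function.Surjective f := Polynomial.map_surjective _ residue_surjective
    obtain ⟨q, hq⟩ := (IsPrincipalIdealRing.principal (P.map f)).principal
    have hqP : q ∈ P.map f := by rw [hq]; exact Submodule.mem_span_singleton_self q
    obtain ⟨p, hp, rfl⟩ := (Ideal.mem_map_iff_of_surjective f hf).mp hqP
    refine ⟨Polynomial.aeval y p, (hmemC _).mpr ⟨p, rfl⟩, hp, fun h => absurd h hy1,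
      fun F hF => ?_⟩
    have h1 : f F ∈ P.map f := Ideal.mem_map_of_mem f hF
    rw [hq] at h1
    obtain ⟨r, hr⟩ := Submodule.mem_span_singleton.mp h1
    obtain ⟨h, rfl⟩ := hf r
    have h2 : f (F - h * p) = 0 := by
      rw [map_sub, map_mul, ← hr, smul_eq_mul, sub_self]
    have h3 : Polynomial.aeval y F =
        Polynomial.aeval y h * Polynomial.aeval y p + Polynomial.aeval y (F - h * p) := by
      simp
    rw [h3]
    refine Submodule.add_mem _ ?_ ?_
    · exact Submodule.smul_mem _ (⟨_, (hmemC _).mpr ⟨h, rfl⟩⟩ : C)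
        (Submodule.subset_span (Set.mem_insert _ _))
    · rw [Polynomial.aeval_eq_sum_range (p := F - h * p)]
      refine Submodule.sum_mem _ fun i _ => ?_
      have h4 : residue B ((F - h * p).coeff i) = 0 := by
        rw [← Polynomial.coeff_map]
        exact (congrArg (fun q => Polynomial.coeff q i) h2).trans (Polynomial.coeff_zero i)
      rw [residue_eq_zero_iff, hB.mem_maximalIdeal_iff] at h4
      have h5 := span_le_span hBC (Set.subset_insert (Polynomial.aeval y p) G)
        (hG.2 _ ((F - h * p).coeff i).2 h4)
      have h6 := Submodule.smul_mem _ (⟨y ^ i, C.pow_mem hyC i⟩ : C) h5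
      rw [Subring.smul_def, smul_eq_mul, mul_comm] at h6
      exact h6

end ValuationSubring

namespace LocalSubring

variable {K : Type*} [Field K]

theorem mem_ofPrime_iff {C : Subring K} {P : Ideal C} [P.IsPrime] {z : K} :
    z ∈ (ofPrime C P).toSubring ↔ ∃ x s : C, s ∉ P ∧ z = (x : K) / s := by
  constructor
  · intro hz
    obtain ⟨⟨x, s⟩, hxs⟩ := IsLocalization.surj P.primeCompl (⟨z, hz⟩ : (ofPrime C P).toSubring)
    have hs0 : ((s : C) : K) ≠ 0 := fun h => s.2 (by
      rw [show (s : C) = 0 from Subtype.ext h]; exact P.zero_mem)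
    have h : z * ((s : C) : K) = x := congrArg Subtype.val hxs
    exact ⟨x, s, s.2, by rw [← h, mul_div_cancel_right₀ _ hs0]⟩
  · rintro ⟨x, s, hs, rfl⟩
    have hs0 : (s : K) ≠ 0 := fun h => hs (by
      rw [show s = 0 from Subtype.ext h]; exact P.zero_mem)
    have hu := IsLocalization.map_units (ofPrime C P).toSubring (⟨s, hs⟩ : P.primeCompl)
    obtain ⟨t, ht⟩ := isUnit_iff_exists_inv.mp hu
    have h : (s : K) * t = 1 := congrArg Subtype.val ht
    rw [div_eq_mul_inv, inv_eq_of_mul_eq_one_right h]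
    exact Subring.mul_mem _ (le_ofPrime C P x.2) t.2

theorem mem_centerOn_iff {V : ValuationSubring K} {C : Subring K}
    (h : C ≤ V.toLocalSubring.toSubring) (s : C) :
    s ∈ V.toLocalSubring.centerOn h ↔ V.valuation (s : K) < 1 :=
  V.valuation_lt_one_iff (⟨s, h s.2⟩ : V)

/-- The elements outside the center are those of value exactly `1`. -/
theorem toSubring_ofPrime_centerOn {V : ValuationSubring K} {C : Subring K}
    (h : C ≤ V.toLocalSubring.toSubring) :
    (ofPrime C (V.toLocalSubring.centerOn h)).toSubring = V.hull C := by
  ext z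
  have h1 : ∀ s : C, s ∉ V.toLocalSubring.centerOn h ↔ V.valuation (s : K) = 1 := by
    intro s
    rw [mem_centerOn_iff, not_lt]
    have : V.valuation (s : K) ≤ 1 := (V.valuation_le_one_iff _).mpr (h s.2)
    exact ⟨fun h => le_antisymm this h, fun h => h.ge⟩
  rw [mem_ofPrime_iff, ValuationSubring.mem_hull]
  constructor
  · rintro ⟨x, s, hs, rfl⟩
    exact ⟨x, x.2, s, s.2, (h1 s).mp hs, rfl⟩
  · rintro ⟨x, hx, s, hs, hvs, rfl⟩
    exact ⟨⟨x, hx⟩, ⟨s, hs⟩, (h1 _).mpr hvs, rfl⟩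

end LocalSubring

namespace ValuationSubring

variable {K : Type*} [Field K] {V : ValuationSubring K}

theorem isNoetherianRing_hull {C : Subring K} (h : C ≤ V.toSubring) [IsNoetherianRing C] :
    IsNoetherianRing (V.hull C) := by
  have h' : C ≤ V.toLocalSubring.toSubring := h
  rw [← LocalSubring.toSubring_ofPrime_centerOn h']
  exact IsLocalization.isNoetherianRing (V.toLocalSubring.centerOn h').primeCompl _ inferInstance

theorem closure_union_le {B : Subring K} (hB : B ≤ V.toSubring) {S : Set K} (hS : ∀ y ∈ S, y ∈ V) :
    Subring.closure (B ∪ S) ≤ V.toSubring := by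
  rw [Subring.closure_le]
  rintro z (hz | hz)
  · exact hB hz
  · exact hS z hz

theorem adjoin_singleton_le {B D : Subring K} (hB : B ≤ D) {y : K} (hy : y ∈ D) :
    (Algebra.adjoin B {y}).toSubring ≤ D := by
  intro z hz
  change z ∈ Algebra.adjoin B {y} at hz
  induction hz using Algebra.adjoin_induction with
  | mem x hx => rwa [Set.mem_singleton_iff.mp hx]
  | algebraMap r => exact hB r.2
  | add x y _ _ hx hy => exact D.add_mem hx hy
  | mul x y _ _ hx hy => exact D.mul_mem hx hy

/-- Localizing after each adjunction or once at the end gives the same ring, so finitely many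
elements can be adjoined one by one. -/
theorem hull_adjoin_hull_closure {B : Subring K} (hB : B ≤ V.toSubring) {S : Set K}
    (hS : ∀ y ∈ S, y ∈ V) {y : K} (hy : y ∈ V) :
    V.hull (Algebra.adjoin (V.hull (Subring.closure (B ∪ S))) {y}).toSubring =
      V.hull (Subring.closure (B ∪ insert y S)) := by
  have hS' : ∀ z ∈ insert y S, z ∈ V := by
    rintro z (rfl | hz)
    exacts [hy, hS z hz]
  have h1 := dominates_hull (closure_union_le hB hS)
  have h2 := dominates_hull (closure_union_le hB hS')
  apply le_antisymm
  · refine hull_le (adjoin_singleton_le (hull_le ?_ h2) ?_) h2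
    · refine le_trans (Subring.closure_mono ?_) (le_hull _)
      exact Set.union_subset_union_right _ (Set.subset_insert _ _)
    · exact le_hull _ (Subring.subset_closure (Or.inr (Set.mem_insert _ _)))
  · have h3 : V.hull (Subring.closure (B ∪ S)) ≤
        (Algebra.adjoin (V.hull (Subring.closure (B ∪ S))) {y}).toSubring :=
      fun z hz => (Algebra.adjoin (V.hull (Subring.closure (B ∪ S))) {y}).algebraMap_mem ⟨z, hz⟩
    refine hull_le (le_trans ?_ (le_hull _)) (dominates_hull (adjoin_singleton_le h1.1 hy))
    rw [Subring.closure_le]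
    rintro z (hz | rfl | hz)
    · exact h3 (le_hull _ (Subring.subset_closure (Or.inl hz)))
    · exact Algebra.subset_adjoin rfl
    · exact h3 (le_hull _ (Subring.subset_closure (Or.inr hz)))

theorem Generates.exists_hull_closure {B : Subring K} (hB : V.Dominates B) [IsNoetherianRing B]
    {G : Set K} (hG : V.Generates B G) {ι : Type*} [DecidableEq ι] (y : ι → K)
    (hy : ∀ k, y k ∈ V) (T : Finset ι) :
    IsNoetherianRing (V.hull (Subring.closure (B ∪ y '' (T : Set ι)))) ∧
      ∃ g : ι → K, (∀ k ∈ T, V.valuation (y k) < 1 → g k = y k) ∧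
        V.Generates (V.hull (Subring.closure (B ∪ y '' (T : Set ι)))) (G ∪ g '' (T : Set ι)) := by
  induction T using Finset.induction_on with
  | empty =>
    have h : V.hull (Subring.closure (B ∪ y '' ((∅ : Finset ι) : Set ι))) = B := by
      rw [Finset.coe_empty, Set.image_empty, Set.union_empty, Subring.closure_eq]
      exact le_antisymm (hull_le le_rfl hB) (le_hull _)
    rw [h]
    exact ⟨inferInstance, y, by simp, by simpa using hG⟩
  | insert k T hk ih =>
    obtain ⟨hN, g, hg, hgen⟩ := ih
    have hT : ∀ z ∈ y '' (T : Set ι), z ∈ V := by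
      rintro _ ⟨i, -, rfl⟩
      exact hy i
    have hdom := dominates_hull (closure_union_le hB.1 hT)
    have heq := hull_adjoin_hull_closure hB.1 hT (hy k)
    rw [Finset.coe_insert, Set.image_insert_eq, ← heq]
    obtain ⟨g', hg', hgen'⟩ := hgen.exists_hull_adjoin hdom (hy k)
    refine ⟨?_, Function.update g k g', ?_, ?_⟩
    · have : IsNoetherianRing
          (Algebra.adjoin (V.hull (Subring.closure (B ∪ y '' (T : Set ι)))) {y k}).toSubring :=
        isNoetherianRing_of_fg (Subalgebra.fg_def.mpr ⟨{y k}, Set.finite_singleton _, rfl⟩)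
      exact isNoetherianRing_hull (adjoin_singleton_le hdom.1 (hy k))
    · intro i hi hvi
      by_cases hik : i = k
      · subst hik
        rw [Function.update_self, hg' hvi]
      · rw [Function.update_of_ne hik]
        exact hg i ((Finset.mem_insert.mp hi).resolve_left hik) hvi
    · have h1 : Function.update g k g' '' insert k (T : Set ι) = insert g' (g '' (T : Set ι)) := by
        rw [Set.image_insert_eq, Function.update_self]
        congr 1
        refine Set.image_congr fun i hi => Function.update_of_ne ?_ _ _
        rintro rfl
        exact hk hi
      rwa [h1, Set.union_insert]

end ValuationSubring

/-! ### Quadratic transforms and their parameters. -/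

namespace ValuationSubring

variable {K : Type*} [Field K] {V : ValuationSubring K}

theorem valuation_le_of_mem_span {B : Subring K} (hB : B ≤ V.toSubring) {G : Set K}
    {γ : V.ValueGroup} (hG : ∀ g ∈ G, V.valuation g ≤ γ) {z : K} (hz : z ∈ Submodule.span B G) :
    V.valuation z ≤ γ := by
  induction hz using Submodule.span_induction with
  | mem x hx => exact hG x hx
  | zero => simp
  | add x y _ _ hx hy => exact V.valuation.map_add_le hx hy
  | smul a x _ hx =>
    rw [Subring.smul_def, smul_eq_mul, map_mul]
    exact (mul_le_of_le_one_left' ((V.valuation_le_one_iff _).mpr (hB a.2))).trans hx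

theorem valuation_lt_of_mem_span {B : Subring K} (hB : B ≤ V.toSubring) {G : Set K}
    {γ : V.ValueGroup} (hγ : 0 < γ) (hG : ∀ g ∈ G, V.valuation g < γ) {z : K}
    (hz : z ∈ Submodule.span B G) : V.valuation z < γ := by
  induction hz using Submodule.span_induction with
  | mem x hx => exact hG x hx
  | zero => simpa using hγ
  | add x y _ _ hx hy => exact V.valuation.map_add_lt hx hy
  | smul a x _ hx =>
    rw [Subring.smul_def, smul_eq_mul, map_mul]
    exact lt_of_le_of_lt
      (mul_le_of_le_one_left' ((V.valuation_le_one_iff _).mpr (hB a.2))) hx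

end ValuationSubring

namespace LocalSubring

variable {K : Type*} [Field K] {V : ValuationSubring K} {d : ℕ}

theorem IsRegularSystemOfParameters.generates {A : LocalSubring K} (hA : V.Dominates A.toSubring)
    {w : Fin d → K} (hw : IsRegularSystemOfParameters A w) :
    V.Generates A.toSubring (Set.range w) := by
  obtain ⟨-, -, y, hy, hspan⟩ := hw
  have hyw : w = fun k => (y k : K) := funext fun k => (hy k).symm
  refine ⟨?_, fun z hz hv => ?_⟩
  · rintro _ ⟨k, rfl⟩
    rw [← hy k, ← hA.mem_maximalIdeal_iff, ← hspan]
    exact ⟨(y k).2, Ideal.subset_span ⟨k, rfl⟩⟩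
  · rw [hyw]
    have := A.toSubring.coe_mem_span_range_iff y ⟨z, hz⟩
    rw [this, hspan, hA.mem_maximalIdeal_iff]
    exact hv

/-- Having `d` generators bounds the dimension above by `d`; with the assumed lower bound the ring
is regular. -/
theorem isRegularSystemOfParameters_of_generates {B : LocalSubring K}
    (hB : V.Dominates B.toSubring) [IsNoetherianRing B.toSubring] {w : Fin d → K}
    (hw : V.Generates B.toSubring (Set.range w)) (hd : d ≤ ringKrullDim B.toSubring) :
    IsRegularSystemOfParameters B w := by
  let y : Fin d → B.toSubring := fun k => ⟨w k, (hw.1 _ ⟨k, rfl⟩).1⟩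
  have hspan : Ideal.span (Set.range y) = maximalIdeal B.toSubring := by
    ext z
    rw [← Subring.coe_mem_span_range_iff, hB.mem_maximalIdeal_iff]
    refine ⟨fun hz => ?_, hw.2 z z.2⟩
    exact ValuationSubring.valuation_lt_of_mem_span hB.1 zero_lt_one
      (fun g hg => (hw.1 g hg).2) hz
  have hdim := le_antisymm (ringKrullDim_le_of_span_range_eq_maximalIdeal hspan) hd
  refine ⟨.of_spanFinrank_maximalIdeal_le _ ?_, hdim, y, fun _ => rfl, hspan⟩
  rw [hdim, ← hspan]
  have h1 := Submodule.spanFinrank_span_le_ncard_of_finite (R := B.toSubring) (Set.finite_range y)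
  have h2 : (Set.range y).ncard ≤ d := by
    rw [← Set.image_univ]
    exact (Set.ncard_image_le Set.finite_univ).trans (by simp)
  exact_mod_cast h1.trans h2

theorem le_blowupChart (A : LocalSubring K) (a : K) : A.toSubring ≤ A.blowupChart a :=
  fun b hb => (Algebra.adjoin A.toSubring _).algebraMap_mem ⟨b, hb⟩

theorem div_mem_blowupChart {A : LocalSubring K} (hA : V.Dominates A.toSubring) (a : K) {b : K}
    (hb : b ∈ A.toSubring) (hv : V.valuation b < 1) : b / a ∈ A.blowupChart a :=
  Algebra.subset_adjoin ⟨⟨b, hb⟩, (hA.mem_maximalIdeal_iff _).mpr hv, rfl⟩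

theorem blowupChart_le {A : LocalSubring K} (hA : V.Dominates A.toSubring) {a : K} {D : Subring K}
    (hAD : A.toSubring ≤ D) (h : ∀ b ∈ A.toSubring, V.valuation b < 1 → b / a ∈ D) :
    A.blowupChart a ≤ D := by
  intro z hz
  change z ∈ Algebra.adjoin A.toSubring _ at hz
  induction hz using Algebra.adjoin_induction with
  | mem x hx =>
    obtain ⟨b, hb, rfl⟩ := hx
    exact h b b.2 ((hA.mem_maximalIdeal_iff _).mp hb)
  | algebraMap r => exact hAD r.2
  | add x y _ _ hx hy => exact D.add_mem hx hy
  | mul x y _ _ hx hy => exact D.mul_mem hx hy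

/-- `b / a = (b / a') / (a / a')`, and `a / a'` has value `1`. Hence the transform does not depend
on the choice of `a`. -/
theorem blowupChart_le_hull_blowupChart {A : LocalSubring K} (hA : V.Dominates A.toSubring)
    {a a' : K} (ha : a ∈ A.toSubring) (hav : V.valuation a < 1) (h : V.valuation a = V.valuation a')
    (ha' : a' ≠ 0) : A.blowupChart a ≤ V.hull (A.blowupChart a') := by
  refine blowupChart_le hA ((le_blowupChart A a').trans (ValuationSubring.le_hull _)) ?_
  intro b hb hbv
  refine ⟨b / a', div_mem_blowupChart hA a' hb hbv, a / a', div_mem_blowupChart hA a' ha hav,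
    ?_, ?_⟩
  · rw [map_div₀, h, div_self]
    exact (map_ne_zero _).mpr ha'
  · rw [div_div_div_cancel_right₀ ha']

theorem blowupChart_le_of_valuation_le {A : LocalSubring K} (hA : V.Dominates A.toSubring) {a : K}
    (ha : ∀ b ∈ A.toSubring, V.valuation b < 1 → V.valuation b ≤ V.valuation a) :
    A.blowupChart a ≤ V.toSubring := by
  refine blowupChart_le hA hA.1 fun b hb hbv => ?_
  change b / a ∈ V
  rw [← V.valuation_le_one_iff, map_div₀]
  exact div_le_one_of_le₀ (ha b hb hbv) zero_le

theorem hull_blowupChart_eq {A : LocalSubring K} (hA : V.Dominates A.toSubring)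
    {a a' : K} (ha : a ∈ A.toSubring) (hav : V.valuation a < 1) (ha' : a' ∈ A.toSubring)
    (h : V.valuation a = V.valuation a') (ha0 : a' ≠ 0)
    (hmax : ∀ b ∈ A.toSubring, V.valuation b < 1 → V.valuation b ≤ V.valuation a) :
    V.hull (A.blowupChart a) = V.hull (A.blowupChart a') := by
  have h0 : a ≠ 0 := by
    rintro rfl
    rw [map_zero, eq_comm, map_eq_zero] at h
    exact ha0 h
  apply le_antisymm
  · exact ValuationSubring.hull_le (blowupChart_le_hull_blowupChart hA ha hav h ha0)
      (ValuationSubring.dominates_hull (blowupChart_le_of_valuation_le hA (h ▸ hmax)))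
  · exact ValuationSubring.hull_le (blowupChart_le_hull_blowupChart hA ha' (h ▸ hav) h.symm h0)
      (ValuationSubring.dominates_hull (blowupChart_le_of_valuation_le hA hmax))

theorem blowupChart_eq_closure {A : LocalSubring K} (hA : V.Dominates A.toSubring)
    {w : Fin d → K} (hw : V.Generates A.toSubring (Set.range w)) {j : Fin d} (hj : w j ≠ 0) :
    A.blowupChart (w j) = Subring.closure
      (A.toSubring ∪ (fun k => w k / w j) '' ((Finset.univ.erase j : Finset (Fin d)) : Set _)) := by
  set D := Subring.closure
      (A.toSubring ∪ (fun k => w k / w j) '' ((Finset.univ.erase j : Finset (Fin d)) : Set _))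
  have hAD : A.toSubring ≤ D := fun z hz => Subring.subset_closure (Or.inl hz)
  apply le_antisymm
  · refine blowupChart_le hA hAD fun b hb hbv => ?_
    obtain ⟨c, rfl⟩ := Submodule.mem_span_range_iff_exists_fun _ |>.mp (hw.2 b hb hbv)
    rw [Finset.sum_div]
    refine sum_mem fun k _ => ?_
    rw [Subring.smul_def, smul_eq_mul, mul_div_assoc]
    refine D.mul_mem (hAD (c k).2) ?_
    by_cases hk : k = j
    · rw [hk, div_self hj]
      exact D.one_mem
    · exact Subring.subset_closure (Or.inr ⟨k, by simpa using hk, rfl⟩)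
  · rw [Subring.closure_le]
    rintro _ (hz | ⟨k, -, rfl⟩)
    · exact le_blowupChart _ _ hz
    · exact div_mem_blowupChart hA _ (hw.1 _ ⟨k, rfl⟩).1 (hw.1 _ ⟨k, rfl⟩).2

theorem IsQuadraticTransformAlong.toSubring_eq_hull {A B : LocalSubring K}
    (hA : V.Dominates A.toSubring) (hAB : IsQuadraticTransformAlong V A B) {w : Fin d → K}
    (hw : V.Generates A.toSubring (Set.range w)) {j : Fin d} (hj : w j ≠ 0)
    (hmax : ∀ k, V.valuation (w k) ≤ V.valuation (w j)) :
    A.blowupChart (w j) ≤ V.toSubring ∧ B.toSubring = V.hull (A.blowupChart (w j)) := by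
  have hmax' : ∀ b ∈ A.toSubring, V.valuation b < 1 → V.valuation b ≤ V.valuation (w j) := by
    intro b hb hbv
    refine ValuationSubring.valuation_le_of_mem_span hA.1 ?_ (hw.2 b hb hbv)
    rintro _ ⟨k, rfl⟩
    exact hmax k
  obtain ⟨a, ha, hav, h, rfl⟩ := hAB
  have hwj := hw.1 _ ⟨j, rfl⟩
  have ha1 := (hA.mem_maximalIdeal_iff _).mp ha
  have heq : V.valuation (a : K) = V.valuation (w j) :=
    le_antisymm (hmax' a a.2 ha1) (hav ⟨w j, hwj.1⟩ ((hA.mem_maximalIdeal_iff _).mpr hwj.2))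
  refine ⟨blowupChart_le_of_valuation_le hA hmax', ?_⟩
  rw [toSubring_ofPrime_centerOn]
  exact hull_blowupChart_eq hA a.2 ha1 hwj.1 heq hj (heq ▸ hmax')

/-- Regular systems of parameters along a quadratic transform. -/
theorem IsQuadraticTransformAlong.exists_isRegularSystemOfParameters {A B : LocalSubring K}
    (hA : V.Dominates A.toSubring) (hAB : IsQuadraticTransformAlong V A B) {w : Fin d → K}
    (hw : IsRegularSystemOfParameters A w) {j : Fin d} (hj : w j ≠ 0)
    (hmax : ∀ k, V.valuation (w k) ≤ V.valuation (w j))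
    (hdim : ∀ C : LocalSubring K, V.Dominates C.toSubring → A.toSubring ≤ C.toSubring →
      IsNoetherianRing C.toSubring → d ≤ ringKrullDim C.toSubring) :
    V.Dominates B.toSubring ∧ A.toSubring ≤ B.toSubring ∧ (∀ k, w k / w j ∈ B.toSubring) ∧
      ∃ w' : Fin d → K,
      IsRegularSystemOfParameters B w' ∧ w' j = w j ∧
        ∀ k ≠ j, V.valuation (w k) < V.valuation (w j) → w' k = w k / w j := by
  have hgen := hw.generates hA
  obtain ⟨hV, hB⟩ := hAB.toSubring_eq_hull hA hgen hj hmax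
  have hdom : V.Dominates B.toSubring := hB ▸ ValuationSubring.dominates_hull hV
  have hle : A.blowupChart (w j) ≤ B.toSubring := hB ▸ ValuationSubring.le_hull _
  have hAB' := (le_blowupChart A (w j)).trans hle
  have hyB : ∀ k, w k / w j ∈ B.toSubring := fun k =>
    hle (div_mem_blowupChart hA _ (hgen.1 _ ⟨k, rfl⟩).1 (hgen.1 _ ⟨k, rfl⟩).2)
  have := hw.1
  obtain ⟨hN, g, hg, hgen'⟩ := hgen.exists_hull_closure hA (fun k => w k / w j)
    (fun k => hdom.1 (hyB k)) (Finset.univ.erase j)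
  rw [← blowupChart_eq_closure hA hgen hj, ← hB] at hN hgen'
  have hw' : ∀ k ≠ j, Function.update g j (w j) k = g k := fun k hk =>
    Function.update_of_ne hk _ _
  -- Adjoining the `d - 1` quotients leaves the generators `w k` together with `g k` for `k ≠ j`.
  -- Each `w k` is a multiple of `w j`, so `w j` alone, put in the free slot `j`, suffices.
  refine ⟨hdom, hAB', hyB, Function.update g j (w j), ?_, Function.update_self _ _ _, ?_⟩
  · refine isRegularSystemOfParameters_of_generates hdom ⟨?_, fun z hz hv => ?_⟩
      (hdim B hdom hAB' hN)
    · rintro _ ⟨k, rfl⟩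
      by_cases hk : k = j
      · rw [hk, Function.update_self]
        exact hgen'.1 _ (Or.inl ⟨j, rfl⟩)
      · rw [hw' k hk]
        exact hgen'.1 _ (Or.inr ⟨k, by simpa using hk, rfl⟩)
    · have h1 := hgen'.2 z hz hv
      refine (Submodule.span_le.mpr ?_ : Submodule.span B.toSubring _ ≤ _) h1
      rintro _ (⟨k, rfl⟩ | ⟨k, hk, rfl⟩)
      · have h2 : w j ∈ Submodule.span B.toSubring (Set.range (Function.update g j (w j))) :=
          Submodule.subset_span ⟨j, Function.update_self _ _ _⟩
        have h3 := Submodule.smul_mem _ (⟨_, hyB k⟩ : B.toSubring) h2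
        rwa [Subring.smul_def, smul_eq_mul, div_mul_cancel₀ _ hj] at h3
      · exact Submodule.subset_span ⟨k, hw' k (by simpa using hk)⟩
  · intro k hk hlt
    rw [hw' k hk]
    refine hg k (by simpa using hk) ?_
    rw [map_div₀]
    exact (div_lt_one₀ (zero_lt_iff.mpr ((map_ne_zero _).mpr hj))).mpr hlt

/-- If one of the variables has strictly smaller value than all the others, then the quadratic
transform is monomial. -/
theorem IsQuadraticTransformAlong.isMonomialTransform {A B : LocalSubring K}
    (hA : V.Dominates A.toSubring) (hAB : IsQuadraticTransformAlong V A B) {w : Fin d → K}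
    (hw : V.Generates A.toSubring (Set.range w)) {j : Fin d} (hj : w j ≠ 0)
    (hmax : ∀ k ≠ j, V.valuation (w k) < V.valuation (w j)) :
    IsMonomialTransform A w j B := by
  obtain ⟨hV, hB⟩ := hAB.toSubring_eq_hull hA hw hj (fun k => by
    by_cases hk : k = j
    · rw [hk]
    · exact (hmax k hk).le)
  have hV' : A.blowupChart (w j) ≤ V.toLocalSubring.toSubring := hV
  set C := A.blowupChart (w j) with hC
  have hwA := fun k => hw.1 _ ⟨k, rfl⟩
  have hAC : A.toSubring ≤ C := le_blowupChart _ _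
  have hmem : ∀ k, monomialStep j w k ∈ C ∧ V.valuation (monomialStep j w k) < 1 := by
    intro k
    by_cases hk : k = j
    · rw [monomialStep, if_pos hk]
      exact ⟨hAC (hwA j).1, (hwA j).2⟩
    · rw [monomialStep, if_neg hk]
      refine ⟨div_mem_blowupChart hA _ (hwA k).1 (hwA k).2, ?_⟩
      rw [map_div₀]
      exact (div_lt_one₀ (zero_lt_iff.mpr ((map_ne_zero _).mpr hj))).mpr (hmax k hk)
  let y : Fin d → C := fun k => ⟨monomialStep j w k, (hmem k).1⟩
  have hyj : y j = ⟨w j, hAC (hwA j).1⟩ := Subtype.ext (if_pos rfl)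
  have hwspan : ∀ k, (⟨w k, hAC (hwA k).1⟩ : C) ∈ Ideal.span (Set.range y) := by
    intro k
    have h1 : y j ∈ Ideal.span (Set.range y) := Ideal.subset_span ⟨j, rfl⟩
    have h2 := Ideal.mul_mem_left _
      ⟨w k / w j, div_mem_blowupChart hA _ (hwA k).1 (hwA k).2⟩ h1
    rw [hyj] at h2
    convert h2 using 1
    exact Subtype.ext (div_mul_cancel₀ _ hj).symm
  have hlt : ∀ z ∈ Ideal.span (Set.range y), V.valuation (z : K) < 1 := by
    intro z hz
    rw [← Subring.coe_mem_span_range_iff] at hz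
    refine ValuationSubring.valuation_lt_of_mem_span hV zero_lt_one ?_ hz
    rintro _ ⟨k, rfl⟩
    exact (hmem k).2
  -- modulo the ideal generated by the new variables, every element of the chart comes from `A`
  have hmod : ∀ z (hz : z ∈ Subring.closure (A.toSubring ∪ (fun k => w k / w j) ''
      ((Finset.univ.erase j : Finset (Fin d)) : Set _))), ∃ hzC : z ∈ C, ∃ b : A.toSubring,
        (⟨z, hzC⟩ : C) - Subring.inclusion hAC b ∈ Ideal.span (Set.range y) := by
    intro z hz
    induction hz using Subring.closure_induction with
    | mem z hz =>
      obtain hz | ⟨k, hk, rfl⟩ := hz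
      · refine ⟨hAC hz, ⟨z, hz⟩, ?_⟩
        have : (⟨z, hAC hz⟩ : C) - Subring.inclusion hAC ⟨z, hz⟩ = 0 := sub_self _
        rw [this]
        exact zero_mem _
      · refine ⟨div_mem_blowupChart hA _ (hwA k).1 (hwA k).2, 0, ?_⟩
        rw [map_zero, sub_zero]
        refine Ideal.subset_span ⟨k, Subtype.ext (if_neg ?_)⟩
        simpa using hk
    | zero => exact ⟨C.zero_mem, 0, by
        rw [map_zero, sub_zero]
        exact (Ideal.span (Set.range y)).zero_mem⟩
    | one => exact ⟨C.one_mem, 1, by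
        have : (⟨1, C.one_mem⟩ : C) - Subring.inclusion hAC 1 = 0 := sub_self _
        rw [this]
        exact zero_mem _⟩
    | add x z _ _ hx hz =>
      obtain ⟨hxC, b, hb⟩ := hx
      obtain ⟨hzC, c, hc⟩ := hz
      refine ⟨C.add_mem hxC hzC, b + c, ?_⟩
      convert add_mem hb hc using 1
      rw [map_add, sub_add_sub_comm]
      rfl
    | neg x _ hx =>
      obtain ⟨hxC, b, hb⟩ := hx
      refine ⟨C.neg_mem hxC, -b, ?_⟩
      convert neg_mem hb using 1
      rw [map_neg, neg_sub']
      rfl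
    | mul x z _ _ hx hz =>
      obtain ⟨hxC, b, hb⟩ := hx
      obtain ⟨hzC, c, hc⟩ := hz
      refine ⟨C.mul_mem hxC hzC, b * c, ?_⟩
      have h1 := add_mem (Ideal.mul_mem_right ⟨z, hzC⟩ _ hb)
        (Ideal.mul_mem_left _ (Subring.inclusion hAC b) hc)
      convert h1 using 1
      have h2 : (⟨x * z, C.mul_mem hxC hzC⟩ : C) = ⟨x, hxC⟩ * ⟨z, hzC⟩ := rfl
      rw [h2, map_mul]
      ring
  -- An element of the center is congruent to some `b` from `A`; then `b` has value less than `1`,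
  -- so it is a combination of the `w k`, which lie in the ideal.
  have hspan : Ideal.span (Set.range y) = V.toLocalSubring.centerOn hV' := by
    ext z
    rw [mem_centerOn_iff]
    refine ⟨hlt z, fun hz => ?_⟩
    obtain ⟨hzC, b, hb⟩ := hmod z (by rw [← blowupChart_eq_closure hA hw hj]; exact z.2)
    have hb1 : V.valuation (b : K) < 1 := by
      have h1 := V.valuation.map_sub_lt hz (hlt _ hb)
      have h2 : (z : K) - (((⟨z, hzC⟩ : C) - Subring.inclusion hAC b : C) : K) = b :=
        sub_sub_cancel (z : K) (b : K)
      rwa [h2] at h1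
    obtain ⟨c, hc⟩ := Submodule.mem_span_range_iff_exists_fun _ |>.mp (hw.2 b b.2 hb1)
    have h3 : Subring.inclusion hAC b ∈ Ideal.span (Set.range y) := by
      have h4 : Subring.inclusion hAC b =
          ∑ k, Subring.inclusion hAC (c k) * ⟨w k, hAC (hwA k).1⟩ := by
        apply Subtype.ext
        change (b : K) = _
        rw [← hc, AddSubmonoidClass.coe_finsetSum]
        rfl
      rw [h4]
      exact sum_mem fun k _ => Ideal.mul_mem_left _ _ (hwspan k)
    have h5 := add_mem hb h3
    rwa [sub_add_cancel] at h5
  have hBC : B = ofPrime C (V.toLocalSubring.centerOn hV') :=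
    toSubring_injective (by rw [hB, toSubring_ofPrime_centerOn])
  -- The ideal is a variable here so that it can be replaced together with its primality instance.
  have key : ∀ I : Ideal C, I = V.toLocalSubring.centerOn hV' →
      ∃ _ : I.IsPrime, B = ofPrime C I := by
    rintro _ rfl
    exact ⟨inferInstance, hBC⟩
  exact ⟨y, fun _ => rfl, key _ hspan⟩

end LocalSubring

/-! ### Values in `ℚ ⊗ Γ` and the consequences of rank 1. -/

namespace ValuationSubring

variable {K : Type*} [Field K] (V : ValuationSubring K)

open Classical in
/-- The value of `x`, as a vector of `ℚ ⊗ Γ` (and `0` for `x = 0`). -/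
noncomputable def valueVec (x : K) : ℚ ⊗[ℤ] Additive (V.ValueGroup)ˣ :=
  if h : x = 0 then 0 else
    (1 : ℚ) ⊗ₜ[ℤ] Additive.ofMul (Units.mk0 (V.valuation x) ((map_ne_zero _).mpr h))

variable {V}

theorem valueVec_zero : V.valueVec 0 = 0 := dif_pos rfl

theorem valueVec_of_ne_zero {x : K} (h : x ≠ 0) : V.valueVec x =
    (1 : ℚ) ⊗ₜ[ℤ] Additive.ofMul (Units.mk0 (V.valuation x) ((map_ne_zero _).mpr h)) := dif_neg h

theorem valueVec_congr {x y : K} (h : V.valuation x = V.valuation y) :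
    V.valueVec x = V.valueVec y := by
  by_cases hx : x = 0
  · have hy : y = 0 := by rwa [hx, map_zero, eq_comm, map_eq_zero] at h
    rw [hx, hy]
  · have hy : y ≠ 0 := by
      rintro rfl
      rw [map_zero, map_eq_zero] at h
      exact hx h
    rw [valueVec_of_ne_zero hx, valueVec_of_ne_zero hy]
    congr 2
    exact Units.ext h

theorem valueVec_mul {x y : K} (hx : x ≠ 0) (hy : y ≠ 0) :
    V.valueVec (x * y) = V.valueVec x + V.valueVec y := by
  rw [valueVec_of_ne_zero hx, valueVec_of_ne_zero hy, valueVec_of_ne_zero (mul_ne_zero hx hy),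
    ← TensorProduct.tmul_add, ← ofMul_mul]
  congr 2
  exact Units.ext (map_mul _ _ _)

theorem valueVec_one : V.valueVec 1 = 0 := by
  have h := valueVec_mul (V := V) (one_ne_zero (α := K)) one_ne_zero
  rwa [mul_one, left_eq_add] at h

theorem valueVec_div {x y : K} (hx : x ≠ 0) (hy : y ≠ 0) :
    V.valueVec (x / y) = V.valueVec x - V.valueVec y := by
  rw [eq_sub_iff_add_eq, ← valueVec_mul (div_ne_zero hx hy) hy, div_mul_cancel₀ _ hy]

theorem valueVec_pow {x : K} (hx : x ≠ 0) (n : ℕ) :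
    V.valueVec (x ^ n) = n • V.valueVec x := by
  induction n with
  | zero => rw [pow_zero, valueVec_one, zero_smul]
  | succ n ih => rw [pow_succ, valueVec_mul (pow_ne_zero _ hx) hx, ih, succ_nsmul]

theorem valueVec_prod {ι : Type*} (s : Finset ι) {f : ι → K} (hf : ∀ i, f i ≠ 0) :
    V.valueVec (∏ i ∈ s, f i) = ∑ i ∈ s, V.valueVec (f i) := by
  classical
  induction s using Finset.induction_on with
  | empty => rw [Finset.prod_empty, Finset.sum_empty, valueVec_one]
  | insert i s hi ih =>
    rw [Finset.prod_insert hi, Finset.sum_insert hi,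
      valueVec_mul (hf i) (Finset.prod_ne_zero_iff.mpr fun i _ => hf i), ih]

theorem injective_valuation_prod_pow {d : ℕ} {f : Fin d → K} (hf : ∀ i, f i ≠ 0)
    (h : LinearIndependent ℚ fun i => V.valueVec (f i)) :
    Function.Injective fun a : Fin d → ℕ => V.valuation (∏ i, f i ^ a i) := by
  intro a b hab
  have h1 := valueVec_congr hab
  rw [valueVec_prod _ fun i => pow_ne_zero _ (hf i),
    valueVec_prod _ fun i => pow_ne_zero _ (hf i)] at h1
  simp only [valueVec_pow (hf _), ← Nat.cast_smul_eq_nsmul ℚ] at h1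
  rw [← sub_eq_zero, ← Finset.sum_sub_distrib] at h1
  simp only [← sub_smul] at h1
  have h2 := Fintype.linearIndependent_iff.mp h (fun i => (a i : ℚ) - b i) h1
  exact funext fun i => by exact_mod_cast sub_eq_zero.mp (h2 i)

theorem span_valueVec_eq_top {A : Subring K}
    (hA : ∀ z : K, ∃ x ∈ A, ∃ y ∈ A, y ≠ 0 ∧ z = x / y) :
    Submodule.span ℚ (V.valueVec '' {x | x ∈ A ∧ x ≠ 0}) = ⊤ := by
  refine _root_.eq_top_iff.mpr ?_
  rintro t -
  induction t using TensorProduct.induction_on with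
  | zero => exact Submodule.zero_mem _
  | add x y hx hy => exact Submodule.add_mem _ hx hy
  | tmul q γ =>
    obtain ⟨z, hz⟩ := V.valuation_surjective (γ.toMul : V.ValueGroup)
    obtain ⟨x, hx, y, hy, hy0, rfl⟩ := hA z
    have hx0 : x ≠ 0 := by
      rintro rfl
      rw [zero_div, map_zero] at hz
      exact (γ.toMul).ne_zero hz.symm
    have h1 : q ⊗ₜ[ℤ] γ = q • V.valueVec (x / y) := by
      rw [valueVec_of_ne_zero (div_ne_zero hx0 hy0), TensorProduct.smul_tmul', smul_eq_mul,
        mul_one]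
      congr 1
      apply Additive.toMul.injective
      exact Units.ext hz.symm
    rw [h1, valueVec_div hx0 hy0]
    exact Submodule.smul_mem _ _ (Submodule.sub_mem _ (Submodule.subset_span ⟨x, ⟨hx, hx0⟩, rfl⟩)
      (Submodule.subset_span ⟨y, ⟨hy, hy0⟩, rfl⟩))

/-- Values of elements of `A` already span, by taking fractions, so a basis can be chosen among
them. Being in `A`, the `f i` lie in every later ring of the sequence. -/
theorem exists_linearIndependent_valueVec {d : ℕ} (hd : V.rationalRank = d) {A : Subring K}
    (hA : ∀ z : K, ∃ x ∈ A, ∃ y ∈ A, y ≠ 0 ∧ z = x / y) :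
    ∃ f : Fin d → K, (∀ i, f i ∈ A ∧ f i ≠ 0) ∧
      LinearIndependent ℚ fun i => V.valueVec (f i) := by
  obtain ⟨b, hbs, hspan, hli⟩ :=
    exists_linearIndependent ℚ (V.valueVec '' {x | x ∈ A ∧ x ≠ 0})
  have hcard : Cardinal.mk b = d := by
    rw [← rank_span_set hli, hspan, span_valueVec_eq_top hA, rank_top]
    exact hd
  obtain ⟨e⟩ : Nonempty (Fin d ≃ b) := by
    rw [← Cardinal.lift_mk_eq', hcard]
    simp
  choose f hf hfe using fun i => hbs (e i).2
  refine ⟨f, hf, ?_⟩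
  simp only [hfe]
  exact hli.comp _ e.injective

/-- For `y` in `V`, every prime containing `y` is nonzero, hence maximal, hence contains `x`; so `x`
is in the radical of `(y)`. -/
theorem exists_pow_lt_of_ringKrullDim_eq_one (h : ringKrullDim V = 1) {x y : K}
    (hx : V.valuation x < 1) (hy : y ≠ 0) : ∃ c : ℕ, V.valuation x ^ c < V.valuation y := by
  by_cases hyV : V.valuation y ≤ 1
  · have hyV' := (V.valuation_le_one_iff y).mp hyV
    have hxV := (V.valuation_le_one_iff x).mp hx.le
    have : Ring.KrullDimLE 1 V := (Ring.krullDimLE_iff).mpr h.le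
    have hmem : (⟨x, hxV⟩ : V) ∈ (Ideal.span {(⟨y, hyV'⟩ : V)}).radical := by
      rw [Ideal.radical_eq_sInf, Submodule.mem_sInf]
      rintro P ⟨hyP, hP⟩
      have hP0 : P ≠ ⊥ := by
        rintro rfl
        rw [Ideal.span_singleton_le_iff_mem, Ideal.mem_bot] at hyP
        exact hy (congrArg Subtype.val hyP)
      have hmax := Ring.krullDimLE_one_iff_of_noZeroDivisors.mp this P hP0 hP
      rw [IsLocalRing.eq_maximalIdeal hmax]
      exact (V.valuation_lt_one_iff _).mpr hx
    obtain ⟨n, hn⟩ := hmem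
    obtain ⟨a, ha⟩ := Ideal.mem_span_singleton'.mp hn
    have h1 : (a : K) * y = x ^ n := congrArg Subtype.val ha
    -- The extra factor `x` makes the inequality strict.
    refine ⟨n + 1, ?_⟩
    have hy0 : 0 < V.valuation y := zero_lt_iff.mpr ((map_ne_zero _).mpr hy)
    rw [pow_succ, ← map_pow, ← h1, map_mul]
    calc V.valuation (a : K) * V.valuation y * V.valuation x
        ≤ V.valuation y * V.valuation x :=
          mul_le_mul_left (mul_le_of_le_one_left' (V.valuation_le_one a)) _
      _ < V.valuation y * 1 := mul_lt_mul_of_pos_left hx hy0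
      _ = V.valuation y := mul_one _
  · exact ⟨0, by rwa [pow_zero, ← not_le]⟩

/-- Abhyankar's inequality for local rings dominated by a valuation ring of rank `1`. -/
theorem Dominates.le_ringKrullDim (h : ringKrullDim V = 1) {d : ℕ} {f : Fin d → K}
    (hf0 : ∀ i, f i ≠ 0) (hf : LinearIndependent ℚ fun i => V.valueVec (f i)) {C : Subring K}
    (hC : V.Dominates C) (hfC : ∀ i, f i ∈ C) [IsNoetherianRing C] : d ≤ ringKrullDim C := by
  have := hC.isLocalRing
  have hprod : ∀ a : Fin d → ℕ, C.subtype (∏ i, (⟨f i, hfC i⟩ : C) ^ a i) = ∏ i, f i ^ a i := by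
    intro a
    simp [map_prod]
  refine le_ringKrullDim_of_injective_valuation_monomials (V.valuation.comap C.subtype)
    (fun b => hC.valuation_le_one b.2) (fun i => ⟨f i, hfC i⟩) ?_ ?_
  · have h1 := injective_valuation_prod_pow hf0 hf
    intro a b hab
    apply h1
    simpa only [Valuation.comap_apply, hprod] using hab
  · intro x hx
    have h1 := exists_pow_lt_of_ringKrullDim_eq_one h ((hC.mem_maximalIdeal_iff x).mp hx)
      (Finset.prod_ne_zero_iff.mpr fun i (_ : i ∈ Finset.univ) => hf0 i)
    simpa [Valuation.comap_apply, map_prod] using h1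

end ValuationSubring

/-! ### Factorizations and values of the variables along the sequence. -/

namespace LocalSubring

variable {K : Type*} [Field K] {V : ValuationSubring K} {d : ℕ}

/-- A divisor of a product of variables and units has value in the span of the values of the
variables. -/
theorem IsRegularSystemOfParameters.valueVec_mem_span {A : LocalSubring K}
    (hA : V.Dominates A.toSubring) {w : Fin d → K} (hw : IsRegularSystemOfParameters A w) {z : K}
    (hz : z ∈ Submonoid.closure ({u | u ∈ A.toSubring ∧ V.valuation u = 1} ∪ Set.range w)) :
    ∀ x ∈ A.toSubring, ∀ y ∈ A.toSubring, x * y = z →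
      V.valueVec x ∈ Submodule.span ℚ (Set.range fun k => V.valueVec (w k)) := by
  have hgen := hw.generates hA
  obtain ⟨hreg, hdim, p, hp, hspan⟩ := hw
  have hprime : ∀ k, Prime (p k) := prime_of_span_range_eq_maximalIdeal hspan hdim.ge
  have hcl : Submonoid.closure ({u | u ∈ A.toSubring ∧ V.valuation u = 1} ∪ Set.range w) ≤
      A.toSubring.toSubmonoid := by
    rw [Submonoid.closure_le]
    rintro z (hz | hz)
    exacts [hz.1, (hgen.1 z hz).1]
  -- One factor of `z` is removed at a time, for all factorizations `x * y = z` at once: a unit is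
  -- moved into `y`, and a prime variable is cancelled from `x` or from `y`.
  induction hz using Submonoid.closure_induction_left with
  | one =>
    intro x hx y hy hxy
    have h1 : V.valuation x = V.valuation 1 := by
      rw [map_one]
      refine (hA.isUnit_iff ⟨x, hx⟩).mp (IsUnit.of_mul_eq_one ⟨y, hy⟩ (Subtype.ext hxy))
    rw [ValuationSubring.valueVec_congr h1, ValuationSubring.valueVec_one]
    exact Submodule.zero_mem _
  | mul_left t ht z hz ih =>
    intro x hx y hy hxy
    obtain ⟨htA, ht1⟩ | ⟨k, rfl⟩ := ht
    · have ht0 : t ≠ 0 := fun h => by simp [h] at ht1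
      refine ih x hx (t⁻¹ * y) (mul_mem (hA.2 t htA ht1) hy) ?_
      rw [mul_left_comm, hxy, inv_mul_cancel_left₀ ht0]
    · have hk0 : w k ≠ 0 := fun h => (hprime k).ne_zero (Subtype.ext ((hp k).trans h))
      have hdvd : p k ∣ ⟨x, hx⟩ * ⟨y, hy⟩ :=
        ⟨⟨z, hcl hz⟩, Subtype.ext (by rw [Subring.coe_mul, Subring.coe_mul, hp k]; exact hxy)⟩
      obtain ⟨c, hc⟩ | ⟨c, hc⟩ := (hprime k).dvd_or_dvd hdvd
      · have hxc : x = w k * c := by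
          rw [← hp k]; exact congrArg Subtype.val hc
        subst hxc
        rw [mul_assoc] at hxy
        have h1 := ih c c.2 y hy (mul_left_cancel₀ hk0 hxy)
        by_cases hc0 : (c : K) = 0
        · rw [hc0, mul_zero, ValuationSubring.valueVec_zero]
          exact Submodule.zero_mem _
        · rw [ValuationSubring.valueVec_mul hk0 hc0]
          exact Submodule.add_mem _ (Submodule.subset_span ⟨k, rfl⟩) h1
      · have hyc : y = w k * c := by
          rw [← hp k]; exact congrArg Subtype.val hc
        subst hyc
        rw [mul_left_comm] at hxy
        exact ih x hx c c.2 (mul_left_cancel₀ hk0 hxy)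

/-- Some variable has the least value, and this variable is not zero. -/
theorem exists_valuation_max {A : Subring K} {w : Fin d → K}
    (hw : V.Generates A (Set.range w)) {z : K} (hz : z ∈ A) (hz0 : z ≠ 0)
    (hz1 : V.valuation z < 1) :
    ∃ j, w j ≠ 0 ∧ ∀ k, V.valuation (w k) ≤ V.valuation (w j) := by
  obtain ⟨c, hc⟩ := Submodule.mem_span_range_iff_exists_fun _ |>.mp (hw.2 z hz hz1)
  obtain ⟨i, hi⟩ : ∃ i, w i ≠ 0 := by
    by_contra! h
    exact hz0 (by rw [← hc]; simp [h])
  have : Nonempty (Fin d) := ⟨i⟩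
  obtain ⟨j, hj⟩ := Finite.exists_max fun k => V.valuation (w k)
  refine ⟨j, fun h => ?_, hj⟩
  have h1 := hj i
  rw [h, map_zero, le_zero_iff, map_eq_zero] at h1
  exact hi h1

theorem exists_isRegularSystemOfParameters {A : LocalSubring K}
    (hA : IsRegularLocalRing A.toSubring) (hd : ringKrullDim A.toSubring = d) :
    ∃ w : Fin d → K, IsRegularSystemOfParameters A w := by
  have hfg : (maximalIdeal A.toSubring).FG := IsNoetherian.noetherian _
  have hcard : (maximalIdeal A.toSubring).generators.ncard = d := by
    rw [Submodule.FG.generators_ncard hfg]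
    have h := hA.spanFinrank_maximalIdeal
    rw [hd] at h
    exact_mod_cast h
  have hfin : (maximalIdeal A.toSubring).generators.Finite := Submodule.FG.finite_generators hfg
  have : Finite (maximalIdeal A.toSubring).generators := hfin
  let e : Fin d ≃ (maximalIdeal A.toSubring).generators :=
    (finCongr hcard.symm).trans (Finite.equivFin _).symm
  refine ⟨fun k => ((e k : A.toSubring) : K), hA, hd, fun k => e k, fun _ => rfl, ?_⟩
  have : Set.range (fun k => (e k : A.toSubring)) = (maximalIdeal A.toSubring).generators := by
    rw [show (fun k => (e k : A.toSubring)) = Subtype.val ∘ e from rfl, Set.range_comp,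
      e.range_eq_univ, Set.image_univ, Subtype.range_coe]
  rw [this]
  exact Submodule.span_generators _

theorem isRegularLocalRing_range {R : Type*} [CommRing R] [IsRegularLocalRing R] {f : R →+* K}
    (hf : Function.Injective f) :
    IsRegularLocalRing (range f).toSubring ∧
      ringKrullDim (range f).toSubring = ringKrullDim R := by
  let e : R ≃+* f.range := RingEquiv.ofBijective f.rangeRestrict
    ⟨fun x y h => hf (congrArg Subtype.val h), f.rangeRestrict_surjective⟩
  exact ⟨.of_ringEquiv (R' := f.range) e, (ringKrullDim_eq_of_ringEquiv e).symm⟩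

end LocalSubring

namespace LocalSubring

variable {K : Type*} [Field K] {V : ValuationSubring K} {d : ℕ}

/-- Once the values of the variables span `ℚ ⊗ Γ`, with `d` the rational rank, the next
quadratic transform is monomial and the values of the new variables span again. -/
theorem IsQuadraticTransformAlong.exists_monomialStep {A B : LocalSubring K}
    (hA : V.Dominates A.toSubring) (hAB : IsQuadraticTransformAlong V A B)
    (hrat : V.rationalRank = d) {w : Fin d → K} (hw : IsRegularSystemOfParameters A w)
    (hspan : ⊤ ≤ Submodule.span ℚ (Set.range fun k => V.valueVec (w k)))
    {z : K} (hz : z ∈ A.toSubring) (hz0 : z ≠ 0) (hz1 : V.valuation z < 1)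
    (hdim : ∀ C : LocalSubring K, V.Dominates C.toSubring → A.toSubring ≤ C.toSubring →
      IsNoetherianRing C.toSubring → d ≤ ringKrullDim C.toSubring) :
    V.Dominates B.toSubring ∧ A.toSubring ≤ B.toSubring ∧ ∃ j : Fin d,
      IsMonomialTransform A w j B ∧ IsRegularSystemOfParameters B (monomialStep j w) ∧
        ⊤ ≤ Submodule.span ℚ (Set.range fun k => V.valueVec (monomialStep j w k)) := by
  have hgen := hw.generates hA
  obtain ⟨j, hj0, hj⟩ := exists_valuation_max hgen hz hz0 hz1
  have hfin : Module.finrank ℚ (ℚ ⊗[ℤ] Additive (V.ValueGroup)ˣ) = d :=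
    Module.finrank_eq_of_rank_eq hrat
  -- `d` spanning vectors in dimension `d` are independent, so no two variables share a value and
  -- the extremal one is strict.
  have hli : LinearIndependent ℚ fun k => V.valueVec (w k) :=
    linearIndependent_of_top_le_span_of_card_eq_finrank hspan (by rw [Fintype.card_fin, hfin])
  have hlt : ∀ k ≠ j, V.valuation (w k) < V.valuation (w j) := fun k hk =>
    lt_of_le_of_ne (hj k) fun h => hk (hli.injective (ValuationSubring.valueVec_congr h))
  obtain ⟨hB, hle, -, w', hw', hwj, hwk⟩ :=
    hAB.exists_isRegularSystemOfParameters hA hw hj0 hj hdim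
  have hw'eq : w' = monomialStep j w := by
    funext k
    by_cases hk : k = j
    · rw [monomialStep, if_pos hk, hk, hwj]
    · rw [monomialStep, if_neg hk, hwk k hk (hlt k hk)]
  refine ⟨hB, hle, j, hAB.isMonomialTransform hA hgen hj0 hlt, hw'eq ▸ hw', hspan.trans ?_⟩
  -- The old value of `w k` is the sum of the new values of `w k / w j` and `w j`.
  rw [Submodule.span_le]
  have hmem : ∀ k, V.valueVec (monomialStep j w k) ∈
      Submodule.span ℚ (Set.range fun k => V.valueVec (monomialStep j w k)) :=
    fun k => Submodule.subset_span ⟨k, rfl⟩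
  have hmj := hmem j
  rw [monomialStep, if_pos rfl] at hmj
  rintro _ ⟨k, rfl⟩
  by_cases hk : k = j
  · rw [hk]
    exact hmj
  · have hk0 : w k ≠ 0 := fun h => hli.ne_zero k (by rw [h, ValuationSubring.valueVec_zero])
    have h1 := hmem k
    rw [monomialStep, if_neg hk, ValuationSubring.valueVec_div hk0 hj0] at h1
    have h2 := Submodule.add_mem _ h1 hmj
    rwa [sub_add_cancel] at h2

/-- A product of variables and units stays a product of variables and units after a
quadratic transform. -/
theorem IsQuadraticTransformAlong.exists_mem_closure {A B : LocalSubring K}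
    (hA : V.Dominates A.toSubring) (hAB : IsQuadraticTransformAlong V A B)
    {w : Fin d → K} (hw : IsRegularSystemOfParameters A w) {z : K} (hz : z ∈ A.toSubring)
    (hz0 : z ≠ 0) (hz1 : V.valuation z < 1)
    (hzw : z ∈ Submonoid.closure ({u | u ∈ A.toSubring ∧ V.valuation u = 1} ∪ Set.range w))
    (hdim : ∀ C : LocalSubring K, V.Dominates C.toSubring → A.toSubring ≤ C.toSubring →
      IsNoetherianRing C.toSubring → d ≤ ringKrullDim C.toSubring) :
    V.Dominates B.toSubring ∧ A.toSubring ≤ B.toSubring ∧ ∃ w' : Fin d → K,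
      IsRegularSystemOfParameters B w' ∧
        z ∈ Submonoid.closure ({u | u ∈ B.toSubring ∧ V.valuation u = 1} ∪ Set.range w') := by
  obtain ⟨j, hj0, hj⟩ := exists_valuation_max (hw.generates hA) hz hz0 hz1
  obtain ⟨hB, hle, hdiv, w', hw', hwj, hwk⟩ :=
    hAB.exists_isRegularSystemOfParameters hA hw hj0 hj hdim
  refine ⟨hB, hle, w', hw', ?_⟩
  set M := Submonoid.closure ({u | u ∈ B.toSubring ∧ V.valuation u = 1} ∪ Set.range w')
  refine (Submonoid.closure_le (S := M)).mpr ?_ hzw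
  have hjM : w j ∈ M := Submonoid.subset_closure (Or.inr ⟨j, hwj⟩)
  rintro _ (⟨hu, hu1⟩ | ⟨k, rfl⟩)
  · exact Submonoid.subset_closure (Or.inl ⟨hle hu, hu1⟩)
  · have hkM : w k / w j ∈ M := by
      by_cases hk : V.valuation (w k) < V.valuation (w j)
      · have hkj : k ≠ j := fun h => by simp [h] at hk
        exact Submonoid.subset_closure (Or.inr ⟨k, hwk k hkj hk⟩)
      · refine Submonoid.subset_closure (Or.inl ⟨hdiv k, ?_⟩)
        rw [map_div₀, le_antisymm (hj k) (not_lt.mp hk), div_self ((map_ne_zero _).mpr hj0)]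
    have h1 := M.mul_mem hkM hjM
    rwa [div_mul_cancel₀ _ hj0] at h1

end LocalSubring

/-! ### The main theorem. -/

/-- Otherwise all of `K` except `0` would have value `1` and `V` would be a field. The element
guarantees a nonzero variable in each ring of the sequence. -/
theorem ValuationSubring.exists_valuation_lt_one {K : Type*} [Field K] {V : ValuationSubring K}
    (hrank : ringKrullDim V = 1) {A : Subring K} (hA : A ≤ V.toSubring)
    (hfrac : ∀ z : K, ∃ x ∈ A, ∃ y ∈ A, y ≠ 0 ∧ z = x / y) :
    ∃ z ∈ A, z ≠ 0 ∧ V.valuation z < 1 := by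
  by_contra! h
  have h1 : ∀ z ∈ A, z ≠ 0 → V.valuation z = 1 := fun z hz hz0 =>
    le_antisymm ((V.valuation_le_one_iff z).mpr (hA hz)) (h z hz hz0)
  have hfield : IsField V := by
    rw [isField_iff_maximalIdeal_eq, eq_bot_iff]
    intro v hv
    rw [V.valuation_lt_one_iff] at hv
    by_contra hv0
    obtain ⟨x, hx, y, hy, hy0, hxy⟩ := hfrac v
    have hx0 : x ≠ 0 := by
      rintro rfl
      rw [zero_div] at hxy
      exact hv0 (Subtype.ext hxy)
    rw [hxy, map_div₀, h1 x hx hx0, h1 y hy hy0, div_one] at hv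
    exact lt_irrefl _ hv
  have h2 := ringKrullDim_eq_zero_of_isField hfield
  rw [hrank] at h2
  exact one_ne_zero h2

theorem mainTheorem10 {R K : Type*} [CommRing R] [IsRegularLocalRing R] [Field K] [Algebra R K]
    [IsFractionRing R K] (d : ℕ) (hd : ringKrullDim R = d)
    (V : ValuationSubring K)
    (hdom : LocalSubring.range (algebraMap R K) ≤ V.toLocalSubring)
    (hrank : ringKrullDim V = 1)
    (hrat : V.rationalRank = d)
    (S : ℕ → LocalSubring K)
    (hS : LocalSubring.IsQuadraticSequenceAlong V (LocalSubring.range (algebraMap R K)) S)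
    (hunion : (V : Set K) = ⋃ n, ((S n).toSubring : Set K)) :
    ∃ (n : ℕ) (x : Fin d → K), LocalSubring.IsRegularSystemOfParameters (S n) x ∧
      LocalSubring.IsMonomialSequence (fun i => S (n + i)) x := by
  obtain ⟨hS0, hS⟩ := hS
  set A := LocalSubring.range (algebraMap R K) with hAdef
  have hA : V.Dominates A.toSubring := ValuationSubring.dominates_of_le hdom
  have hfrac : ∀ z : K, ∃ x ∈ A.toSubring, ∃ y ∈ A.toSubring, y ≠ 0 ∧ z = x / y := by
    intro z
    obtain ⟨x, y, hy, rfl⟩ := IsFractionRing.div_surjective (A := R) z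
    refine ⟨_, ⟨x, rfl⟩, _, ⟨y, rfl⟩, ?_, rfl⟩
    exact (IsLocalization.map_units K (⟨y, hy⟩ : nonZeroDivisors R)).ne_zero
  obtain ⟨f, hf, hli⟩ := ValuationSubring.exists_linearIndependent_valueVec hrat hfrac
  have hdim : ∀ B : LocalSubring K, A.toSubring ≤ B.toSubring →
      ∀ C : LocalSubring K, V.Dominates C.toSubring → B.toSubring ≤ C.toSubring →
      IsNoetherianRing C.toSubring → d ≤ ringKrullDim C.toSubring := by
    intro B hAB C hC hBC _
    exact hC.le_ringKrullDim hrank (fun i => (hf i).2) hli (fun i => hBC (hAB (hf i).1))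
  obtain ⟨z, hz, hz0, hz1⟩ := ValuationSubring.exists_valuation_lt_one hrank hA.1 hfrac
  obtain ⟨hreg, hdimA⟩ := LocalSubring.isRegularLocalRing_range (IsFractionRing.injective R K)
  obtain ⟨w₀, hw₀⟩ := LocalSubring.exists_isRegularSystemOfParameters hreg (hdimA.trans hd)
  have hgen := hw₀.generates hA
  -- a variable whose image stays a product of variables and units in all the rings `S n`
  obtain ⟨j, hj0, -⟩ := LocalSubring.exists_valuation_max hgen hz hz0 hz1
  obtain ⟨hjA, hj1⟩ := hgen.1 _ ⟨j, rfl⟩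
  have hseq : ∀ n, V.Dominates (S n).toSubring ∧ A.toSubring ≤ (S n).toSubring ∧
      ∃ w : Fin d → K, LocalSubring.IsRegularSystemOfParameters (S n) w ∧
        w₀ j ∈ Submonoid.closure
          ({u | u ∈ (S n).toSubring ∧ V.valuation u = 1} ∪ Set.range w) := by
    intro n
    induction n with
    | zero =>
      rw [hS0]
      exact ⟨hA, le_rfl, w₀, hw₀, Submonoid.subset_closure (Or.inr ⟨j, rfl⟩)⟩
    | succ n ih =>
      obtain ⟨hn, hAn, w, hw, hjw⟩ := ih
      obtain ⟨h1, h2, h3⟩ :=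
        (hS n).exists_mem_closure hn hw (hAn hjA) hj0 hj1 hjw (hdim _ hAn)
      exact ⟨h1, hAn.trans h2, h3⟩
  -- in some `S n` the product of the `f i` divides a power of this variable
  have hF0 : ∏ i, f i ≠ 0 := Finset.prod_ne_zero_iff.mpr fun i _ => (hf i).2
  obtain ⟨c, hc⟩ := ValuationSubring.exists_pow_lt_of_ringKrullDim_eq_one hrank hj1 hF0
  have hq : w₀ j ^ c / ∏ i, f i ∈ (V : Set K) := by
    change _ ∈ V
    rw [← V.valuation_le_one_iff, map_div₀, map_pow]
    exact div_le_one_of_le₀ hc.le zero_le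
  rw [hunion] at hq
  obtain ⟨n, hn⟩ := Set.mem_iUnion.mp hq
  obtain ⟨hSn, hAn, w, hw, hjw⟩ := hseq n
  have hspan : ⊤ ≤ Submodule.span ℚ (Set.range fun k => V.valueVec (w k)) := by
    have hfin : Module.finrank ℚ (ℚ ⊗[ℤ] Additive (V.ValueGroup)ˣ) = d :=
      Module.finrank_eq_of_rank_eq hrat
    obtain rfl | hd0 := Nat.eq_zero_or_pos d
    · exact j.elim0
    have : Nonempty (Fin d) := ⟨j⟩
    rw [← hli.span_eq_top_of_card_eq_finrank (by rw [Fintype.card_fin, hfin]), Submodule.span_le]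
    rintro _ ⟨i, rfl⟩
    -- The cofactor of `f i` in `w₀ j ^ c` is the product of the other `f k` with the quotient found
    -- in `S n`.
    refine hw.valueVec_mem_span hSn (Submonoid.pow_mem _ hjw c) (f i) (hAn (hf i).1)
      ((∏ k ∈ Finset.univ.erase i, f k) * (w₀ j ^ c / ∏ i, f i))
      (mul_mem (prod_mem fun k _ => hAn (hf k).1) hn) ?_
    rw [← mul_assoc, Finset.mul_prod_erase _ _ (Finset.mem_univ i), mul_div_cancel₀ _ hF0]
  refine ⟨n, w, hw, ?_⟩
  -- The invariant of the recursion; its last clause makes each next transform monomial.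
  let P : ℕ → (Fin d → K) → Prop := fun i w =>
    V.Dominates (S (n + i)).toSubring ∧ A.toSubring ≤ (S (n + i)).toSubring ∧
      LocalSubring.IsRegularSystemOfParameters (S (n + i)) w ∧
        ⊤ ≤ Submodule.span ℚ (Set.range fun k => V.valueVec (w k))
  have hstep : ∀ i (w : {w // P i w}), ∃ w' : {w // P (i + 1) w}, ∃ j : Fin d,
      LocalSubring.IsMonomialTransform (S (n + i)) w.1 j (S (n + (i + 1))) ∧
        w'.1 = LocalSubring.monomialStep j w.1 := by
    rintro i ⟨w, hPn, hPA, hPw, hPs⟩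
    obtain ⟨h1, h2, k, h3, h4, h5⟩ := (hS (n + i)).exists_monomialStep hPn hrat hPw hPs
      (hPA hz) hz0 hz1 (hdim _ hPA)
    exact ⟨⟨LocalSubring.monomialStep k w, h1, hPA.trans h2, h4, h5⟩, k, h3, rfl⟩
  choose next hnext using hstep
  let s : ∀ i, {w // P i w} := fun i => Nat.rec ⟨w, hSn, hAn, hw, hspan⟩ next i
  exact ⟨fun i => (s i).1, rfl, fun i => (s i).2.2.2.1, fun i => hnext i (s i)⟩
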